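/- Meromorphic first integrals are understood in the following local sense. Let $f$ be a map of a neighbourhood of a point ${\bf x}\in\mathbb R^2$ into $\mathbb R^2$ that is real analytic at ${\bf x}$, with $f({\bf x})={\bf x}$, and denote also by $f$ its holomorphic extension to a neighbourhood of ${\bf x}$ in $\mathbb C^2$. A meromorphic first integral of $f$ at ${\bf x}$ is a quotient $R=G/H$ of two functions that are holomorphic in a neighbourhood of ${\bf x}$ in $\mathbb C^2$, with $H\not\equiv 0$ near ${\bf x}$, such that $G(f(z))H(z)=G(z)H(f(z))$ for all $z\in\mathbb C^2$ near ${\bf x}$. Two such functions $R_1=G_1/H_1$, $R_2=G_2/H_2$ are functionally independent if every neighbourhood of ${\bf x}$ in $\mathbb C^2$ contains a point at which $H_1H_2\neq0$ and at which the differentials of $R_1$ and $R_2$ are linearly independent over $\mathbb C$ (equivalently, these differentials are linearly independent on an open dense subset of a neighbourhood of ${\bf x}$). (1) Let $f$ be a planar map that is real analytic at a fixed point ${\bf x}\in\mathbb R^2$, let $\mu^2+b\mu+c\in\mathbb R[\mu]$ be the characteristic polynomial of the Jacobian matrix ${\rm D}f({\bf x})$, and suppose that $f$ is a local diffeomorphism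 at ${\bf x}$, that is, $c\ne0$. Assume that $f$ has two functionally independent meromorphic first integrals at ${\bf x}$. Then all (complex) eigenvalues of ${\rm D}f({\bf x})$ are roots of unity. In particular, if $b^2-4c<0$ then $c=1$, and if $b^2-4c\ge0$ then $(b,c)\in\{(2,1),(-2,1),(0,-1)\}$. (2) Let $p,q\in\mathbb Z$ with $p\neq0$. If the map $f(x,y)=(y,x^py^q)$ has two functionally independent meromorphic first integrals at its fixed point $(1,1)$, then $$(p,q)\in\{(-1,-2),\,(-1,2),\,(1,0),\,(-1,-1),\,(-1,0),\,(-1,1)\}.$$ -/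

import Mathlib

open Filter Topology

/-- The inclusion of `ℝⁿ` in `ℂⁿ`. -/
def realToComplex {n : ℕ} (x : Fin n → ℝ) : Fin n → ℂ := fun i => (x i : ℂ)

/-- `G / H` is a (germ at `a` of a) meromorphic first integral of the map `F`:
`G` and `H` are holomorphic at `a`, `H` does not vanish identically near `a`, and
`G (F z) * H z = G z * H (F z)` for all `z` near `a`. -/
structure IsMeromorphicFirstIntegral {n : ℕ} (F : (Fin n → ℂ) → (Fin n → ℂ)) (a : Fin n → ℂ)
    (G H : (Fin n → ℂ) → ℂ) : Prop where
  analyticAt_num : AnalyticAt ℂ G a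
  analyticAt_den : AnalyticAt ℂ H a
  den_ne_zero : ∃ᶠ z in 𝓝 a, H z ≠ 0
  invariant : ∀ᶠ z in 𝓝 a, G (F z) * H z = G z * H (F z)

/-- Functional independence, as germs at `a`, of the meromorphic functions `G i / H i`: the
differentials of these functions are not everywhere linearly dependent on any neighbourhood
of `a`. (By the identity theorem this is the same as their being linearly independent on an open
dense subset of some neighbourhood of `a`.) -/
def FunctionallyIndependentAt {n m : ℕ} (a : Fin n → ℂ) (G H : Fin m → (Fin n → ℂ) → ℂ) : Prop :=
  ∃ᶠ z in 𝓝 a, (∀ i, H i z ≠ 0) ∧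
    LinearIndependent ℂ (fun i => fderiv ℂ (fun w => G i w / H i w) z)

/-- `F` is the holomorphic extension of `f` to a neighbourhood of the real point `x` in `ℂⁿ`.
A map that is real analytic at `x` has such an extension, and its germ is unique. -/
def IsComplexificationAt {n : ℕ} (f : (Fin n → ℝ) → (Fin n → ℝ)) (x : Fin n → ℝ)
    (F : (Fin n → ℂ) → (Fin n → ℂ)) : Prop :=
  AnalyticAt ℂ F (realToComplex x) ∧ ∀ᶠ y in 𝓝 x, F (realToComplex y) = realToComplex (f y)

/-- The real analytic map `f` has `m` functionally independent meromorphic first integrals in a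
neighbourhood of its fixed point `x` in `ℂⁿ`. -/
def HasIndependentMeromorphicFirstIntegrals {n : ℕ} (m : ℕ) (f : (Fin n → ℝ) → (Fin n → ℝ))
    (x : Fin n → ℝ) : Prop :=
  ∃ (F : (Fin n → ℂ) → (Fin n → ℂ)) (G H : Fin m → (Fin n → ℂ) → ℂ),
    IsComplexificationAt f x F ∧
    (∀ i, IsMeromorphicFirstIntegral F (realToComplex x) (G i) (H i)) ∧
    FunctionallyIndependentAt (realToComplex x) G H

/-- The Jacobian matrix of `f` at `x`. -/
noncomputable def jacobianMatrix {n : ℕ} (f : (Fin n → ℝ) → (Fin n → ℝ)) (x : Fin n → ℝ) :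
    Matrix (Fin n) (Fin n) ℝ :=
  LinearMap.toMatrix' (fderiv ℝ f x : (Fin n → ℝ) →ₗ[ℝ] (Fin n → ℝ))

/-- The planar map `(x, y) ↦ (y, x ^ p * y ^ q)` with integer exponents. -/
noncomputable def monomialMap (p q : ℤ) (v : Fin 2 → ℝ) : Fin 2 → ℝ :=
  ![v 1, v 0 ^ p * v 1 ^ q]

/-!
Why the eigenvalues are roots of unity. Let `A` be the linear part of the complexified map at the
fixed point, and let `l` be an eigenvalue of `A` that is not a root of unity. In a basis that starts
with an eigenvector for `l`, the map has the form `(x, y) ↦ (l x + e y, m y) + O(2)`. The coordinates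
are given the weights `1` and `√2`. Since `1 < √2 < 2`, the term `e y` and all terms of order at
least two only raise weights, so that for leading terms the map acts like `diag (l, m)`
(`HasLeadingTerm.comp`); since `√2` is irrational, distinct monomials have distinct weights and every
nonzero holomorphic germ has a single leading monomial (`exists_hasLeadingTerm`).

A quotient `R = G / H` thus has a weight and an exponent vector in `ℤ²`, and if `R` is invariant,
its exponent vector lies in the group of all `(p, q)` with `l ^ p * m ^ q = 1`. As `l` is not a root
of unity, any two vectors in this group are proportional
(`mul_eq_mul_of_zpow_mul_zpow_eq_one`). Let `T`, `S` be two invariant quotients, with `T` of positive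
weight, as can be arranged by inverting `T` or subtracting a constant from it. If `S` has nonnegative
weight, some `S ^ M` has the same leading term as a multiple `k * T ^ s`, and
`S' = S ^ M - k * T ^ s` is an invariant quotient of larger weight than `S ^ M`. Since
`dT ∧ dS' = M * S ^ (M - 1) * dT ∧ dS`, the difference of the weights of `dT ∧ dS` (on the
logarithmic vector fields `x ∂/∂x`, `y ∂/∂y`) and of `S` decreases when `S` is replaced by `S'`, by
at least a fixed positive amount, since the group has rank at most one. By Cauchy's estimate this
difference is at least the weight of `T`, so `dT ∧ dS` vanishes identically (`logWedge_descent`).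

Weights are measured by the quasi-homogeneous norm `weightedNorm`: a germ has weight at least `γ`
when it is `O(weightedNorm ^ γ)` at the origin.
-/

open Asymptotics

/-! ### Weights and leading terms -/

/-- The quasi-homogeneous norm on `ℂ × ℂ` for which the coordinates have weights `1` and `√2`. -/
noncomputable def weightedNorm (z : ℂ × ℂ) : ℝ := max ‖z.1‖ (‖z.2‖ ^ (√2)⁻¹)

/-- The weight `a + b √2` of the monomial `x ^ a * y ^ b`. -/
noncomputable def weight (a b : ℕ) : ℝ := a + b * √2

/-- `c * x ^ a * y ^ b` is the term of lowest weight of `g` at the origin: the remainder has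
strictly larger weight. -/
def HasLeadingTerm (g : ℂ × ℂ → ℂ) (a b : ℕ) (c : ℂ) : Prop :=
  c ≠ 0 ∧ ∃ δ > 0, (fun z => g z - c * z.1 ^ a * z.2 ^ b) =O[𝓝 0]
    fun z => weightedNorm z ^ (weight a b + δ)

lemma weight_nonneg (a b : ℕ) : 0 ≤ weight a b := by unfold weight; positivity

lemma weight_add (a b a' b' : ℕ) : weight (a + a') (b + b') = weight a b + weight a' b' := by
  simp only [weight]; push_cast; ring

lemma weight_mul (n a b : ℕ) : weight (n * a) (n * b) = n * weight a b := by
  simp only [weight]; push_cast; ring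

lemma weightedNorm_nonneg (z : ℂ × ℂ) : 0 ≤ weightedNorm z :=
  le_max_of_le_left (norm_nonneg _)

lemma norm_fst_le_weightedNorm (z : ℂ × ℂ) : ‖z.1‖ ≤ weightedNorm z := le_max_left _ _

lemma norm_snd_le_weightedNorm (z : ℂ × ℂ) : ‖z.2‖ ≤ weightedNorm z ^ √2 := by
  have h : (‖z.2‖ ^ (√2)⁻¹) ^ √2 ≤ weightedNorm z ^ √2 :=
    Real.rpow_le_rpow (by positivity) (le_max_right _ _) (by positivity)
  rwa [← Real.rpow_mul (norm_nonneg _), inv_mul_cancel₀ (by positivity), Real.rpow_one] at h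

lemma weightedNorm_le {z : ℂ × ℂ} {r : ℝ} (hr : 0 ≤ r) (h1 : ‖z.1‖ ≤ r) (h2 : ‖z.2‖ ≤ r ^ √2) :
    weightedNorm z ≤ r := by
  refine max_le h1 ?_
  calc ‖z.2‖ ^ (√2)⁻¹ ≤ (r ^ √2) ^ (√2)⁻¹ :=
        Real.rpow_le_rpow (norm_nonneg _) h2 (by positivity)
    _ = r := by rw [← Real.rpow_mul hr, mul_inv_cancel₀ (by positivity), Real.rpow_one]

lemma tendsto_weightedNorm : Tendsto weightedNorm (𝓝 0) (𝓝 0) := by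
  have : Continuous weightedNorm :=
    continuous_fst.norm.max (continuous_snd.norm.rpow_const fun _ => Or.inr (by positivity))
  have h := this.tendsto 0
  rwa [show weightedNorm 0 = 0 by simp [weightedNorm]] at h

lemma eventually_weightedNorm_le_one : ∀ᶠ z in 𝓝 (0 : ℂ × ℂ), weightedNorm z ≤ 1 :=
  tendsto_weightedNorm.eventually (ge_mem_nhds one_pos)

lemma weightedNorm_rpow_isBigO {s t : ℝ} (hs : 0 ≤ s) (h : s ≤ t) :
    (fun z => weightedNorm z ^ t) =O[𝓝 0] fun z => weightedNorm z ^ s := by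
  refine IsBigO.of_bound 1 ?_
  filter_upwards [eventually_weightedNorm_le_one] with z hz
  have h0 := weightedNorm_nonneg z
  rw [Real.norm_of_nonneg (by positivity), Real.norm_of_nonneg (by positivity), one_mul]
  exact Real.rpow_le_rpow_of_exponent_ge' h0 hz hs h

lemma weightedNorm_rpow_add {s t : ℝ} (hs : 0 ≤ s) (ht : 0 ≤ t) :
    (fun z => weightedNorm z ^ (s + t)) = fun z => weightedNorm z ^ s * weightedNorm z ^ t := by
  funext z
  exact Real.rpow_add_of_nonneg (weightedNorm_nonneg z) hs ht

lemma isBigO_weightedNorm_mul {g h : ℂ × ℂ → ℂ} {s t : ℝ} (hs : 0 ≤ s) (ht : 0 ≤ t)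
    (hg : g =O[𝓝 0] fun z => weightedNorm z ^ s) (hh : h =O[𝓝 0] fun z => weightedNorm z ^ t) :
    (fun z => g z * h z) =O[𝓝 0] fun z => weightedNorm z ^ (s + t) := by
  rw [weightedNorm_rpow_add hs ht]
  exact hg.mul hh

lemma isBigO_norm_pow_weightedNorm (n : ℕ) :
    (fun z : ℂ × ℂ => ‖z‖ ^ n) =O[𝓝 0] fun z => weightedNorm z ^ (n : ℝ) := by
  refine IsBigO.of_bound 1 ?_
  filter_upwards [eventually_weightedNorm_le_one] with z hz
  have h0 := weightedNorm_nonneg z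
  have : ‖z‖ ≤ weightedNorm z := by
    rw [Prod.norm_def]
    refine max_le (norm_fst_le_weightedNorm z) ((norm_snd_le_weightedNorm z).trans ?_)
    calc weightedNorm z ^ √2 ≤ weightedNorm z ^ (1 : ℝ) :=
          Real.rpow_le_rpow_of_exponent_ge' h0 hz zero_le_one
            (Real.one_le_sqrt.2 (by norm_num))
      _ = _ := Real.rpow_one _
  rw [Real.norm_of_nonneg (by positivity), Real.norm_of_nonneg (by positivity), one_mul,
    Real.rpow_natCast]
  exact pow_le_pow_left₀ (norm_nonneg _) this n

lemma monomial_isBigO (c : ℂ) (a b : ℕ) :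
    (fun z : ℂ × ℂ => c * z.1 ^ a * z.2 ^ b) =O[𝓝 0] fun z => weightedNorm z ^ weight a b := by
  refine IsBigO.of_bound ‖c‖ (Eventually.of_forall fun z => ?_)
  have h0 := weightedNorm_nonneg z
  rw [Real.norm_of_nonneg (by positivity), norm_mul, norm_mul, norm_pow, norm_pow, mul_assoc]
  refine mul_le_mul_of_nonneg_left ?_ (norm_nonneg _)
  calc ‖z.1‖ ^ a * ‖z.2‖ ^ b ≤ weightedNorm z ^ a * (weightedNorm z ^ √2) ^ b := by
        gcongr
        · exact norm_fst_le_weightedNorm z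
        · exact norm_snd_le_weightedNorm z
    _ = weightedNorm z ^ weight a b := by
        rw [weight, Real.rpow_add_of_nonneg h0 (by positivity) (by positivity), Real.rpow_natCast,
          mul_comm (b : ℝ), Real.rpow_mul h0, Real.rpow_natCast]

lemma int_add_int_mul_sqrt_two_injective {a b a' b' : ℤ}
    (h : (a : ℝ) + b * √2 = a' + b' * √2) : a = a' ∧ b = b' := by
  have hb : b = b' := by
    by_contra hne
    have h1 : ((b - b' : ℤ) : ℝ) * √2 = ((a' - a : ℤ) : ℝ) := by push_cast; linarith
    exact (irrational_sqrt_two.intCast_mul (sub_ne_zero.2 hne)).ne_int _ h1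
  subst hb
  exact ⟨by exact_mod_cast add_right_cancel h, rfl⟩

namespace HasLeadingTerm

variable {g h : ℂ × ℂ → ℂ} {a b a' b' : ℕ} {c c' : ℂ}

lemma isBigO (hg : HasLeadingTerm g a b c) :
    g =O[𝓝 0] fun z => weightedNorm z ^ weight a b := by
  obtain ⟨-, δ, hδ, h⟩ := hg
  have := (h.trans (weightedNorm_rpow_isBigO (weight_nonneg a b) (by linarith))).add
    (monomial_isBigO c a b)
  simpa using this

lemma congr (hg : HasLeadingTerm g a b c) (hgh : g =ᶠ[𝓝 0] h) : HasLeadingTerm h a b c := by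
  obtain ⟨hc, δ, hδ, hO⟩ := hg
  refine ⟨hc, δ, hδ, hO.congr' ?_ .rfl⟩
  filter_upwards [hgh] with z hz
  rw [hz]

lemma mul (hg : HasLeadingTerm g a b c) (hh : HasLeadingTerm h a' b' c') :
    HasLeadingTerm (fun z => g z * h z) (a + a') (b + b') (c * c') := by
  have hO := hg.isBigO
  obtain ⟨hc, δ, hδ, h1⟩ := hg
  obtain ⟨hc', δ', hδ', h2⟩ := hh
  refine ⟨mul_ne_zero hc hc', min δ δ', lt_min hδ hδ', ?_⟩
  have w0 := weight_nonneg a b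
  have w1 := weight_nonneg a' b'
  have hm : 0 < min δ δ' := lt_min hδ hδ'
  have e1 := isBigO_weightedNorm_mul w0 (by linarith) hO h2
  have e2 := isBigO_weightedNorm_mul (by linarith) w1 h1 (monomial_isBigO c' a' b')
  have e1' := e1.trans (weightedNorm_rpow_isBigO
    (s := weight (a + a') (b + b') + min δ δ') (by rw [weight_add]; linarith)
    (by rw [weight_add]; linarith [min_le_right δ δ']))
  have e2' := e2.trans (weightedNorm_rpow_isBigO
    (s := weight (a + a') (b + b') + min δ δ') (by rw [weight_add]; linarith)
    (by rw [weight_add]; linarith [min_le_left δ δ']))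
  refine (e1'.add e2').congr_left fun z => ?_
  ring

lemma const (hc : c ≠ 0) : HasLeadingTerm (fun _ => c) 0 0 c :=
  ⟨hc, 1, one_pos, by simpa using isBigO_zero _ _⟩

lemma pow (hg : HasLeadingTerm g a b c) (n : ℕ) :
    HasLeadingTerm (fun z => g z ^ n) (n * a) (n * b) (c ^ n) := by
  induction n with
  | zero => simpa using const one_ne_zero
  | succ n ih => simpa only [pow_succ, Nat.succ_mul] using ih.mul hg

end HasLeadingTerm

/-- The quasi-homogeneous curve `s ↦ (s, s ^ √2)`, on which `weightedNorm` is the parameter. -/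
noncomputable def weightedCurve (s : ℝ) : ℂ × ℂ := ((s : ℂ), ((s ^ √2 : ℝ) : ℂ))

lemma tendsto_weightedCurve : Tendsto weightedCurve (𝓝[>] 0) (𝓝 0) := by
  have : Continuous weightedCurve := by
    refine Complex.continuous_ofReal.prodMk (Complex.continuous_ofReal.comp ?_)
    exact continuous_id.rpow_const fun _ => Or.inr (by positivity)
  have h := this.tendsto 0
  have h0 : weightedCurve 0 = 0 := by
    rw [weightedCurve, Real.zero_rpow (by positivity)]; simp
  rw [h0] at h
  exact h.mono_left nhdsWithin_le_nhds

lemma weightedNorm_weightedCurve {s : ℝ} (hs : 0 < s) : weightedNorm (weightedCurve s) = s := by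
  have hs' : 0 ≤ s ^ √2 := by positivity
  simp only [weightedNorm, weightedCurve, Complex.norm_real, Real.norm_of_nonneg hs.le,
    Real.norm_of_nonneg hs', ← Real.rpow_mul hs.le]
  rw [mul_inv_cancel₀ (by positivity), Real.rpow_one, max_self]

lemma monomial_weightedCurve {s : ℝ} (hs : 0 < s) (c : ℂ) (a b : ℕ) :
    c * (weightedCurve s).1 ^ a * (weightedCurve s).2 ^ b = c * ((s ^ weight a b : ℝ) : ℂ) := by
  simp only [weightedCurve]
  rw [mul_assoc, weight, Real.rpow_add hs, Real.rpow_natCast, mul_comm (b : ℝ),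
    Real.rpow_mul hs.le, Real.rpow_natCast]
  push_cast
  ring

lemma tendsto_div_weightedCurve {g : ℂ × ℂ → ℂ} {v γ : ℝ} (h : v < γ)
    (hg : g =O[𝓝 0] fun z => weightedNorm z ^ γ) :
    Tendsto (fun s : ℝ => g (weightedCurve s) / ((s ^ v : ℝ) : ℂ)) (𝓝[>] 0) (𝓝 0) := by
  have h2 : (fun s : ℝ => g (weightedCurve s) / ((s ^ v : ℝ) : ℂ))
      =O[𝓝[>] 0] fun s : ℝ => s ^ (γ - v) := by
    obtain ⟨C, hC⟩ := (hg.comp_tendsto tendsto_weightedCurve).bound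
    refine IsBigO.of_bound C ?_
    filter_upwards [hC, self_mem_nhdsWithin] with s hs hs0
    have hs0 : 0 < s := hs0
    simp only [Function.comp, weightedNorm_weightedCurve hs0] at hs
    have hw : 0 < s ^ v := by positivity
    rw [norm_div, Complex.norm_real, Real.norm_of_nonneg hw.le, div_le_iff₀ hw]
    refine hs.trans (le_of_eq ?_)
    rw [Real.norm_of_nonneg (by positivity), Real.norm_of_nonneg (by positivity), mul_assoc,
      ← Real.rpow_add hs0, sub_add_cancel]
  have h3 : Tendsto (fun s : ℝ => s ^ (γ - v)) (𝓝[>] 0) (𝓝 0) := by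
    have : Tendsto (fun s : ℝ => s ^ (γ - v)) (𝓝 0) (𝓝 (0 ^ (γ - v))) :=
      (continuous_id.rpow_const fun _ => Or.inr (by linarith)).tendsto 0
    rw [Real.zero_rpow (by linarith)] at this
    exact this.mono_left nhdsWithin_le_nhds
  exact h2.trans_tendsto h3

namespace HasLeadingTerm

variable {g h : ℂ × ℂ → ℂ} {a b a' b' : ℕ} {c c' : ℂ}

/-- On the curve `s ↦ (s, s ^ √2)` the leading term dominates. -/
lemma tendsto_div (hg : HasLeadingTerm g a b c) :
    Tendsto (fun s : ℝ => g (weightedCurve s) / ((s ^ weight a b : ℝ) : ℂ)) (𝓝[>] 0) (𝓝 c) := by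
  obtain ⟨-, δ, hδ, hO⟩ := hg
  have h := (tendsto_div_weightedCurve (v := weight a b) (by linarith) hO).add_const c
  rw [zero_add] at h
  refine h.congr' ?_
  filter_upwards [self_mem_nhdsWithin] with s hs
  have hs : 0 < s := hs
  have hw' : ((s ^ weight a b : ℝ) : ℂ) ≠ 0 := by exact_mod_cast (by positivity : s ^ weight a b ≠ 0)
  rw [monomial_weightedCurve hs]
  field_simp
  ring

lemma le_weight (hg : HasLeadingTerm g a b c) {γ : ℝ}
    (hO : g =O[𝓝 0] fun z => weightedNorm z ^ γ) : γ ≤ weight a b := by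
  by_contra! hlt
  exact hg.1 (tendsto_nhds_unique hg.tendsto_div (tendsto_div_weightedCurve hlt hO))

lemma unique (hg : HasLeadingTerm g a b c) (hg' : HasLeadingTerm g a' b' c') :
    a = a' ∧ b = b' ∧ c = c' := by
  have hw := le_antisymm (hg'.le_weight hg.isBigO) (hg.le_weight hg'.isBigO)
  have hw' : ((a : ℤ) : ℝ) + ((b : ℤ) : ℝ) * √2 = ((a' : ℤ) : ℝ) + ((b' : ℤ) : ℝ) * √2 := by
    simpa [weight] using hw
  obtain ⟨h1, h2⟩ := int_add_int_mul_sqrt_two_injective hw'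
  have h1 : a = a' := by exact_mod_cast h1
  have h2 : b = b' := by exact_mod_cast h2
  subst h1 h2
  exact ⟨rfl, rfl, tendsto_nhds_unique hg.tendsto_div hg'.tendsto_div⟩

lemma not_eventuallyEq_zero (hg : HasLeadingTerm g a b c) : ¬ g =ᶠ[𝓝 0] 0 := by
  intro h0
  have := hg.le_weight (γ := weight a b + 1) ((isBigO_zero _ _).congr' h0.symm .rfl)
  linarith

lemma sub_mul (hg : HasLeadingTerm g a b c) (hh : HasLeadingTerm h a b c') :
    ∃ δ > 0, (fun z => g z - c / c' * h z) =O[𝓝 0] fun z => weightedNorm z ^ (weight a b + δ) := by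
  obtain ⟨-, δ, hδ, h1⟩ := hg
  obtain ⟨hc', δ', hδ', h2⟩ := hh
  have w0 := weight_nonneg a b
  have hm : 0 < min δ δ' := lt_min hδ hδ'
  refine ⟨min δ δ', hm, ?_⟩
  have e1 := h1.trans (weightedNorm_rpow_isBigO (s := weight a b + min δ δ') (by linarith)
    (by linarith [min_le_left δ δ']))
  have e2 := h2.trans (weightedNorm_rpow_isBigO (s := weight a b + min δ δ') (by linarith)
    (by linarith [min_le_right δ δ']))
  refine (e1.sub (e2.const_mul_left (c / c'))).congr_left fun z => ?_
  field_simp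
  ring

end HasLeadingTerm

/-! ### Leading terms of holomorphic germs -/

/-- The restriction to the diagonal of a multilinear form on `ℂ × ℂ` is a homogeneous polynomial in
the coordinates. -/
lemma exists_eq_sum_monomial {n : ℕ} (p : (ℂ × ℂ) [×n]→L[ℂ] ℂ) :
    ∃ c : ℕ → ℂ, ∀ z : ℂ × ℂ,
      p (fun _ => z) = ∑ i ∈ Finset.range (n + 1), c i * z.1 ^ i * z.2 ^ (n - i) := by
  classical
  let q : Finset (Fin n) → ℂ := fun s => p (s.piecewise (fun _ => (1, 0)) fun _ => (0, 1))
  refine ⟨fun i => ∑ s : Finset (Fin n) with s.card = i, q s, fun z => ?_⟩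
  have hz : (fun _ : Fin n => z)
      = (fun _ => z.1 • ((1 : ℂ), (0 : ℂ))) + fun _ => z.2 • ((0 : ℂ), (1 : ℂ)) := by
    funext i; ext <;> simp
  have hq : ∀ s : Finset (Fin n),
      p (s.piecewise (fun _ => z.1 • ((1 : ℂ), (0 : ℂ))) fun _ => z.2 • ((0 : ℂ), (1 : ℂ)))
        = q s * z.1 ^ s.card * z.2 ^ (n - s.card) := by
    intro s
    have : (s.piecewise (fun _ => z.1 • ((1 : ℂ), (0 : ℂ))) fun _ => z.2 • ((0 : ℂ), (1 : ℂ)))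
        = fun i => (s.piecewise (fun _ => z.1) fun _ => z.2) i •
          (s.piecewise (fun _ => ((1 : ℂ), (0 : ℂ))) fun _ => ((0 : ℂ), (1 : ℂ))) i := by
      funext i; by_cases hi : i ∈ s <;> simp [hi]
    rw [this, p.map_smul_univ, Finset.prod_piecewise]
    simp [q, ← Finset.compl_eq_univ_sdiff, Finset.card_compl]
    ring
  rw [hz, p.map_add_univ, Finset.sum_congr rfl fun s _ => hq s]
  rw [← Finset.sum_fiberwise_of_maps_to (s := Finset.univ) (t := Finset.range (n + 1))
    (g := fun s : Finset (Fin n) => s.card)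
    (fun s _ => Finset.mem_range_succ_iff.2 (by simpa using s.card_le_univ))]
  refine Finset.sum_congr rfl fun i _ => ?_
  rw [Finset.sum_mul, Finset.sum_mul]
  refine Finset.sum_congr rfl fun s hs => ?_
  rw [(Finset.mem_filter.1 hs).2]

lemma monomials_isBigO {ι : Type*} (s : Finset ι) (c : ι → ℂ) (a b : ι → ℕ) {γ : ℝ} (hγ : 0 ≤ γ)
    (h : ∀ i ∈ s, c i ≠ 0 → γ ≤ weight (a i) (b i)) :
    (fun z : ℂ × ℂ => ∑ i ∈ s, c i * z.1 ^ a i * z.2 ^ b i) =O[𝓝 0]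
      fun z => weightedNorm z ^ γ := by
  refine IsBigO.fun_sum fun i hi => ?_
  by_cases hc : c i = 0
  · simpa [hc] using isBigO_zero _ _
  · exact (monomial_isBigO _ _ _).trans (weightedNorm_rpow_isBigO hγ (h i hi hc))

/-- As `√2` is irrational, distinct monomials have distinct weights, so a holomorphic germ that is
not zero has a single term of lowest weight. -/
lemma exists_hasLeadingTerm {g : ℂ × ℂ → ℂ} (hg : AnalyticAt ℂ g 0) (h0 : ¬ g =ᶠ[𝓝 0] 0) :
    ∃ a b c, HasLeadingTerm g a b c := by
  classical
  obtain ⟨p, hp⟩ := hg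
  choose c hc using fun n => exists_eq_sum_monomial (p n)
  have hex : ∃ n, ∃ i ∈ Finset.range (n + 1), c n i ≠ 0 := by
    by_contra! hcon
    refine h0 ?_
    filter_upwards [hp.eventually_hasSum] with y hy
    have : ∀ n, p n (fun _ => y) = 0 := fun n => by
      rw [hc]
      exact Finset.sum_eq_zero fun i hi => by simp [hcon n i hi]
    simp only [this, zero_add] at hy
    exact hy.unique hasSum_zero
  obtain ⟨n₀, i₀, hi₀, hne₀⟩ := hex
  obtain ⟨N, hN⟩ := exists_nat_gt (max (n₀ : ℝ) (weight i₀ (n₀ - i₀)))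
  have hn₀N : n₀ < N := by exact_mod_cast (le_max_left _ _).trans_lt hN
  -- the monomials of degree less than `N` which occur in `g`
  let S : Finset (Σ _ : ℕ, ℕ) := (Finset.range N).sigma fun n => Finset.range (n + 1)
  let T := S.filter fun x => c x.1 x.2 ≠ 0
  let wt : (Σ _ : ℕ, ℕ) → ℝ := fun x => weight x.2 (x.1 - x.2)
  have h₀T : (⟨n₀, i₀⟩ : Σ _ : ℕ, ℕ) ∈ T :=
    Finset.mem_filter.2 ⟨Finset.mem_sigma.2 ⟨Finset.mem_range.2 hn₀N, hi₀⟩, hne₀⟩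
  obtain ⟨m, hmT, hmin⟩ := T.exists_min_image wt ⟨_, h₀T⟩
  have hmS := (Finset.mem_filter.1 hmT).1
  have hmc := (Finset.mem_filter.1 hmT).2
  have hmN : wt m < N := ((hmin _ h₀T).trans (le_max_right _ _)).trans_lt hN
  have hstrict : ∀ x ∈ T.erase m, wt m < wt x := by
    intro x hx
    obtain ⟨hxm, hxT⟩ := Finset.mem_erase.1 hx
    refine lt_of_le_of_ne (hmin x hxT) fun heq => hxm ?_
    have hx1 := Finset.mem_range_succ_iff.1 (Finset.mem_sigma.1 (Finset.mem_filter.1 hxT).1).2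
    have hm1 := Finset.mem_range_succ_iff.1 (Finset.mem_sigma.1 hmS).2
    have heq' : ((m.2 : ℤ) : ℝ) + ((m.1 - m.2 : ℕ) : ℤ) * √2
        = ((x.2 : ℤ) : ℝ) + ((x.1 - x.2 : ℕ) : ℤ) * √2 := by
      simpa only [wt, weight, Int.cast_natCast] using heq
    obtain ⟨e1, e2⟩ := int_add_int_mul_sqrt_two_injective heq'
    have e1 : m.2 = x.2 := by exact_mod_cast e1
    have e2 : m.1 - m.2 = x.1 - x.2 := by exact_mod_cast e2
    exact Sigma.ext (by omega) (heq_of_eq e1.symm)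
  obtain ⟨γ, hγm, hγN, hγ⟩ : ∃ γ, wt m < γ ∧ γ ≤ N ∧ ∀ x ∈ T.erase m, γ ≤ wt x := by
    by_cases hne : (T.erase m).Nonempty
    · obtain ⟨y, hy, hy'⟩ := (T.erase m).exists_min_image wt hne
      exact ⟨min N (wt y), lt_min hmN (hstrict y hy), min_le_left _ _,
        fun x hx => (min_le_right _ _).trans (hy' x hx)⟩
    · exact ⟨N, hmN, le_rfl, fun x hx => (hne ⟨x, hx⟩).elim⟩
  have hγ0 : 0 ≤ γ := (weight_nonneg _ _).trans hγm.le
  refine ⟨m.2, m.1 - m.2, c m.1 m.2, hmc, γ - wt m, by linarith, ?_⟩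
  have htail := ((hp.isBigO_sub_partialSum_pow N).trans (isBigO_norm_pow_weightedNorm N)).trans
    (weightedNorm_rpow_isBigO hγ0 hγN)
  have hrest := monomials_isBigO (S.erase m) (fun x => c x.1 x.2) (fun x => x.2)
    (fun x => x.1 - x.2) hγ0 (fun x hx hx0 => hγ x (by
      obtain ⟨h1, h2⟩ := Finset.mem_erase.1 hx
      exact Finset.mem_erase.2 ⟨h1, Finset.mem_filter.2 ⟨h2, hx0⟩⟩))
  have hexp : weight m.2 (m.1 - m.2) + (γ - wt m) = γ := by simp [wt]
  rw [hexp]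
  refine (htail.add hrest).congr_left fun z => ?_
  have hsum : p.partialSum N z = ∑ x ∈ S, c x.1 x.2 * z.1 ^ x.2 * z.2 ^ (x.1 - x.2) := by
    rw [FormalMultilinearSeries.partialSum, Finset.sum_congr rfl fun n _ => hc n z,
      Finset.sum_sigma]
  rw [zero_add, hsum, ← Finset.add_sum_erase S _ hmS]
  ring

/-- A map with triangular linear part multiplies leading coefficients by monomials in the diagonal
entries: since `1 < √2 < 2`, its off-diagonal and nonlinear terms only raise the weight. -/
lemma HasLeadingTerm.comp {g : ℂ × ℂ → ℂ} {a b : ℕ} {c : ℂ} (hg : HasLeadingTerm g a b c)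
    {F : ℂ × ℂ → ℂ × ℂ} {l m : ℂ} (hF0 : Tendsto F (𝓝 0) (𝓝 0))
    (hF1 : HasLeadingTerm (fun z => (F z).1) 1 0 l)
    (hF2 : HasLeadingTerm (fun z => (F z).2) 0 1 m) :
    HasLeadingTerm (fun z => g (F z)) a b (c * (l ^ a * m ^ b)) := by
  obtain ⟨hc, δ, hδ, hO⟩ := hg
  have w0 := weight_nonneg a b
  have hρ : (fun z => weightedNorm (F z)) =O[𝓝 0] weightedNorm := by
    have h1 := hF1.isBigO
    have h2 := hF2.isBigO
    obtain ⟨C₁, hC₁⟩ := h1.bound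
    obtain ⟨C₂, hC₂⟩ := h2.bound
    set C := max 1 (max C₁ C₂)
    have hC1 : 1 ≤ C := le_max_left _ _
    refine IsBigO.of_bound C ?_
    filter_upwards [hC₁, hC₂] with z hz1 hz2
    have hn := weightedNorm_nonneg z
    simp only [weight, Nat.cast_one, Nat.cast_zero, zero_mul, add_zero, one_mul, zero_add,
      Real.rpow_one] at hz1 hz2
    rw [Real.norm_of_nonneg hn] at hz1
    rw [Real.norm_of_nonneg (by positivity)] at hz2
    rw [Real.norm_of_nonneg (weightedNorm_nonneg _), Real.norm_of_nonneg hn]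
    refine weightedNorm_le (by positivity) (hz1.trans ?_) (hz2.trans ?_)
    · gcongr
      exact (le_max_left _ _).trans (le_max_right _ _)
    · rw [Real.mul_rpow (by positivity) hn]
      gcongr
      calc C₂ ≤ C := (le_max_right _ _).trans (le_max_right _ _)
        _ = C ^ (1 : ℝ) := (Real.rpow_one _).symm
        _ ≤ C ^ √2 := Real.rpow_le_rpow_of_exponent_le hC1 (Real.one_le_sqrt.2 (by norm_num))
  have hmono := (hF1.pow a).mul (hF2.pow b)
  simp only [mul_one, mul_zero, add_zero, zero_add] at hmono
  have hmono' := (HasLeadingTerm.const hc).mul hmono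
  rw [zero_add, zero_add] at hmono'
  obtain ⟨hc', δ', hδ', hO'⟩ := hmono'
  have hm : 0 < min δ δ' := lt_min hδ hδ'
  refine ⟨hc', min δ δ', hm, ?_⟩
  have e1 := (hO.comp_tendsto hF0).trans
    (IsBigO.rpow (r := weight a b + δ) (by linarith) (Eventually.of_forall weightedNorm_nonneg) hρ)
  have e1' := e1.trans (weightedNorm_rpow_isBigO (s := weight a b + min δ δ') (by linarith)
    (by linarith [min_le_left δ δ']))
  have e2 := hO'.trans (weightedNorm_rpow_isBigO (s := weight a b + min δ δ') (by linarith)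
    (by linarith [min_le_right δ δ']))
  refine (e1'.add e2).congr_left fun z => ?_
  simp only [Function.comp]
  ring

/-- Cauchy's estimate for the derivative in a direction `u z` that varies with the point, such as
`x ∂/∂x`. -/
lemma fderiv_isBigO_weightedNorm {g : ℂ × ℂ → ℂ} (hg : AnalyticAt ℂ g 0) {γ : ℝ} (hγ : 0 ≤ γ)
    (hO : g =O[𝓝 0] fun z => weightedNorm z ^ γ) {u : ℂ × ℂ → ℂ × ℂ}
    (hu1 : ∀ z, ‖(u z).1‖ ≤ ‖z.1‖) (hu2 : ∀ z, ‖(u z).2‖ ≤ ‖z.2‖) :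
    (fun z => fderiv ℂ g z (u z)) =O[𝓝 0] fun z => weightedNorm z ^ γ := by
  obtain ⟨C, hC0, hC⟩ := hO.exists_nonneg
  obtain ⟨r, hr, hball⟩ := Metric.eventually_nhds_iff_ball.1
    (hC.bound.and hg.eventually_analyticAt)
  refine IsBigO.of_bound (C * 2 ^ γ) ?_
  filter_upwards [Metric.ball_mem_nhds (0 : ℂ × ℂ) (half_pos hr)] with z hz
  have hn := weightedNorm_nonneg z
  have hz : ‖z‖ < r / 2 := by simpa using hz
  have hbd1 : ∀ t : ℂ, ‖t‖ ≤ 1 → ‖(z + t • u z).1‖ ≤ 2 * ‖z.1‖ := fun t ht => by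
    calc ‖(z + t • u z).1‖ ≤ ‖z.1‖ + ‖t‖ * ‖(u z).1‖ := by
          simpa using norm_add_le z.1 (t * (u z).1)
      _ ≤ ‖z.1‖ + 1 * ‖z.1‖ := by gcongr; exact hu1 z
      _ = _ := by ring
  have hbd2 : ∀ t : ℂ, ‖t‖ ≤ 1 → ‖(z + t • u z).2‖ ≤ 2 * ‖z.2‖ := fun t ht => by
    calc ‖(z + t • u z).2‖ ≤ ‖z.2‖ + ‖t‖ * ‖(u z).2‖ := by
          simpa using norm_add_le z.2 (t * (u z).2)
      _ ≤ ‖z.2‖ + 1 * ‖z.2‖ := by gcongr; exact hu2 z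
      _ = _ := by ring
  have hmem : ∀ t : ℂ, ‖t‖ ≤ 1 → z + t • u z ∈ Metric.ball (0 : ℂ × ℂ) r := fun t ht => by
    rw [mem_ball_zero_iff, Prod.norm_def]
    refine max_lt ((hbd1 t ht).trans_lt ?_) ((hbd2 t ht).trans_lt ?_)
    · linarith [norm_fst_le z]
    · linarith [norm_snd_le z]
  have hwn : ∀ t : ℂ, ‖t‖ ≤ 1 → weightedNorm (z + t • u z) ≤ 2 * weightedNorm z := fun t ht => by
    refine weightedNorm_le (by positivity) ((hbd1 t ht).trans ?_) ((hbd2 t ht).trans ?_)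
    · gcongr; exact norm_fst_le_weightedNorm z
    · rw [Real.mul_rpow zero_le_two hn]
      have : (2 : ℝ) ≤ 2 ^ √2 := by
        calc (2 : ℝ) = 2 ^ (1 : ℝ) := (Real.rpow_one _).symm
          _ ≤ 2 ^ √2 := Real.rpow_le_rpow_of_exponent_le one_le_two
            (Real.one_le_sqrt.2 (by norm_num))
      exact mul_le_mul this (norm_snd_le_weightedNorm z) (norm_nonneg _) (by positivity)
  have hline : ∀ t : ℂ, HasDerivAt (fun t : ℂ => z + t • u z) (u z) t := fun t => by
    simpa using ((hasDerivAt_id t).smul_const (u z)).const_add z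
  have hdiff : ∀ t : ℂ, ‖t‖ ≤ 1 →
      HasDerivAt (fun t : ℂ => g (z + t • u z)) (fderiv ℂ g (z + t • u z) (u z)) t := fun t ht =>
    ((hball _ (hmem t ht)).2.differentiableAt.hasFDerivAt).comp_hasDerivAt t (hline t)
  have hd : deriv (fun t : ℂ => g (z + t • u z)) 0 = fderiv ℂ g z (u z) := by
    simpa using (hdiff 0 (by simp)).deriv
  have hcl : DiffContOnCl ℂ (fun t : ℂ => g (z + t • u z)) (Metric.ball 0 1) := by
    refine DifferentiableOn.diffContOnCl fun t ht => ?_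
    rw [closure_ball _ one_ne_zero, mem_closedBall_zero_iff] at ht
    exact (hdiff t ht).differentiableAt.differentiableWithinAt
  have hcauchy := Complex.norm_deriv_le_of_forall_mem_sphere_norm_le
    (C := C * (2 * weightedNorm z) ^ γ) one_pos hcl fun t ht => by
      have ht : ‖t‖ ≤ 1 := (mem_sphere_zero_iff_norm.1 ht).le
      refine ((hball _ (hmem t ht)).1).trans ?_
      rw [Real.norm_of_nonneg (Real.rpow_nonneg (weightedNorm_nonneg _) _)]
      gcongr
      · exact weightedNorm_nonneg _
      · exact hwn t ht
  rw [hd, div_one, Real.mul_rpow zero_le_two hn, ← mul_assoc] at hcauchy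
  rwa [Real.norm_of_nonneg (by positivity)]

/-! ### Invariant quotients and their wedge product -/

/-- The numerator of the derivative of the quotient `G / H` at `z` in the direction `u`. -/
noncomputable def quotientDeriv (G H : ℂ × ℂ → ℂ) (z u : ℂ × ℂ) : ℂ :=
  H z * fderiv ℂ G z u - G z * fderiv ℂ H z u

/-- The numerator of `d(G₁ / H₁) ∧ d(G / H)`, evaluated at `z = (x, y)` on the logarithmic vector
fields `x ∂/∂x` and `y ∂/∂y`. -/
noncomputable def logWedge (G₁ H₁ G H : ℂ × ℂ → ℂ) (z : ℂ × ℂ) : ℂ :=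
  quotientDeriv G₁ H₁ z (z.1, 0) * quotientDeriv G H z (0, z.2)
    - quotientDeriv G₁ H₁ z (0, z.2) * quotientDeriv G H z (z.1, 0)

/-- `G` and `H` are holomorphic at the origin and `G / H` is invariant under `F`, in the form without
denominators. It is not required that `H` is nonzero, so that the notion is symmetric in `G`
and `H`. -/
structure IsInvariantQuotient (F : ℂ × ℂ → ℂ × ℂ) (G H : ℂ × ℂ → ℂ) : Prop where
  num : AnalyticAt ℂ G 0
  den : AnalyticAt ℂ H 0
  invariant : ∀ᶠ z in 𝓝 0, G (F z) * H z = G z * H (F z)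

namespace IsInvariantQuotient

variable {F : ℂ × ℂ → ℂ × ℂ} {G H G₁ H₁ : ℂ × ℂ → ℂ}

lemma swap (h : IsInvariantQuotient F G H) : IsInvariantQuotient F H G where
  num := h.den
  den := h.num
  invariant := by
    filter_upwards [h.invariant] with z hz
    linear_combination -hz

lemma sub_const_mul (h : IsInvariantQuotient F G H) (k : ℂ) :
    IsInvariantQuotient F (fun z => G z - k * H z) H where
  num := h.num.sub (analyticAt_const.mul h.den)
  den := h.den
  invariant := by
    filter_upwards [h.invariant] with z hz
    linear_combination hz

/-- The quotient `(G / H) ^ n - k * (G₁ / H₁) ^ s` of invariant quotients. -/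
lemma pow_sub_mul_pow (h : IsInvariantQuotient F G H) (h₁ : IsInvariantQuotient F G₁ H₁)
    (k : ℂ) (n s : ℕ) :
    IsInvariantQuotient F (fun z => G z ^ n * H₁ z ^ s - k * (G₁ z ^ s * H z ^ n))
      (fun z => H z ^ n * H₁ z ^ s) where
  num := ((h.num.pow n).mul (h₁.den.pow s)).sub
    (analyticAt_const.mul ((h₁.num.pow s).mul (h.den.pow n)))
  den := (h.den.pow n).mul (h₁.den.pow s)
  invariant := by
    filter_upwards [h.invariant, h₁.invariant] with z hz hz₁
    have e := congrArg (· ^ n) hz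
    have e₁ := congrArg (· ^ s) hz₁
    simp only [mul_pow] at e e₁
    linear_combination (H₁ (F z) ^ s * H₁ z ^ s) * e - k * (H (F z) ^ n * H z ^ n) * e₁

/-- The exponents of the leading monomials of `G` and `H` satisfy a multiplicative relation. -/
lemma mul_pow_eq (h : IsInvariantQuotient F G H) (hF0 : Tendsto F (𝓝 0) (𝓝 0)) {l m : ℂ}
    (hF1 : HasLeadingTerm (fun z => (F z).1) 1 0 l)
    (hF2 : HasLeadingTerm (fun z => (F z).2) 0 1 m) {a b a' b' : ℕ} {c c' : ℂ}
    (hG : HasLeadingTerm G a b c) (hH : HasLeadingTerm H a' b' c') :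
    l ^ a * m ^ b = l ^ a' * m ^ b' := by
  have e1 := ((hG.comp hF0 hF1 hF2).mul hH).congr h.invariant
  have e2 := (e1.unique (hG.mul (hH.comp hF0 hF1 hF2))).2.2
  have hc := hG.1
  have hc' := hH.1
  have : c * c' * (l ^ a * m ^ b) = c * c' * (l ^ a' * m ^ b') := by linear_combination e2
  exact mul_left_cancel₀ (mul_ne_zero hc hc') this

end IsInvariantQuotient

lemma quotientDeriv_swap (G H : ℂ × ℂ → ℂ) (z u : ℂ × ℂ) :
    quotientDeriv H G z u = -quotientDeriv G H z u := by
  simp only [quotientDeriv]; ring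

lemma quotientDeriv_sub_const_mul {G H : ℂ × ℂ → ℂ} (k : ℂ) {z : ℂ × ℂ}
    (hG : DifferentiableAt ℂ G z) (hH : DifferentiableAt ℂ H z) (u : ℂ × ℂ) :
    quotientDeriv (fun w => G w - k * H w) H z u = quotientDeriv G H z u := by
  have : fderiv ℂ (fun w => G w - k * H w) z u = fderiv ℂ G z u - k * fderiv ℂ H z u := by
    have e : HasFDerivAt (fun w => G w - k * H w) _ z :=
      hG.hasFDerivAt.sub (hH.hasFDerivAt.const_mul k)
    rw [e.fderiv]
    simp
  simp only [quotientDeriv, this]; ring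

lemma quotientDeriv_eventually_eq_zero {G H : ℂ × ℂ → ℂ} (hG : G =ᶠ[𝓝 0] 0) :
    ∀ᶠ z in 𝓝 0, ∀ u, quotientDeriv G H z u = 0 := by
  filter_upwards [hG, hG.fderiv (𝕜 := ℂ)] with z h1 h2 u
  have h3 : fderiv ℂ (0 : ℂ × ℂ → ℂ) z = 0 := by simp
  simp [quotientDeriv, h1, h2]

/-- The derivative of `S ^ (n + 1) - k * T ^ s`, for `S = G / H` and `T = G₁ / H₁`, is a
combination of those of `S` and `T`. -/
lemma quotientDeriv_pow_sub_mul_pow {G H G₁ H₁ : ℂ × ℂ → ℂ} (k : ℂ) (n s : ℕ) {z : ℂ × ℂ}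
    (hG : DifferentiableAt ℂ G z) (hH : DifferentiableAt ℂ H z)
    (hG₁ : DifferentiableAt ℂ G₁ z) (hH₁ : DifferentiableAt ℂ H₁ z) :
    ∃ β : ℂ, ∀ u, quotientDeriv
      (fun w => G w ^ (n + 1) * H₁ w ^ s - k * (G₁ w ^ s * H w ^ (n + 1)))
      (fun w => H w ^ (n + 1) * H₁ w ^ s) z u
      = (n + 1) * (G z * H z) ^ n * H₁ z ^ (2 * s) * quotientDeriv G H z u
        + β * quotientDeriv G₁ H₁ z u := by
  have eG := hG.hasFDerivAt.pow (n + 1)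
  have eH := hH.hasFDerivAt.pow (n + 1)
  have eG₁ := hG₁.hasFDerivAt.pow s
  have eH₁ := hH₁.hasFDerivAt.pow s
  have e2 : HasFDerivAt (fun w => H w ^ (n + 1) * H₁ w ^ s) _ z := eH.mul eH₁
  have e1 : HasFDerivAt (fun w => G w ^ (n + 1) * H₁ w ^ s - k * (G₁ w ^ s * H w ^ (n + 1))) _ z :=
    (eG.mul eH₁).sub ((eG₁.mul eH).const_mul k)
  refine ⟨-k * s * (G₁ z * H₁ z) ^ (s - 1) * H z ^ (2 * (n + 1)), fun u => ?_⟩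
  unfold quotientDeriv
  rw [e1.fderiv, e2.fderiv]
  rcases s with _ | s
  · simp
    ring
  · simp
    ring

lemma quotientDeriv_isBigO {G H : ℂ × ℂ → ℂ} (hG : AnalyticAt ℂ G 0) (hH : AnalyticAt ℂ H 0)
    {a b a' b' : ℕ} {c c' : ℂ} (lG : HasLeadingTerm G a b c) (lH : HasLeadingTerm H a' b' c')
    {u : ℂ × ℂ → ℂ × ℂ} (hu1 : ∀ z, ‖(u z).1‖ ≤ ‖z.1‖) (hu2 : ∀ z, ‖(u z).2‖ ≤ ‖z.2‖) :
    (fun z => quotientDeriv G H z (u z)) =O[𝓝 0]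
      fun z => weightedNorm z ^ (weight a b + weight a' b') := by
  have w := weight_nonneg a b
  have w' := weight_nonneg a' b'
  have e1 := isBigO_weightedNorm_mul w' w lH.isBigO
    (fderiv_isBigO_weightedNorm hG w lG.isBigO hu1 hu2)
  have e2 := isBigO_weightedNorm_mul w w' lG.isBigO
    (fderiv_isBigO_weightedNorm hH w' lH.isBigO hu1 hu2)
  rw [add_comm] at e1
  exact e1.sub e2

lemma logWedge_isBigO {G H G₁ H₁ : ℂ × ℂ → ℂ} (hG : AnalyticAt ℂ G 0) (hH : AnalyticAt ℂ H 0)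
    (hG₁ : AnalyticAt ℂ G₁ 0) (hH₁ : AnalyticAt ℂ H₁ 0)
    {a b a' b' a₁ b₁ a₁' b₁' : ℕ} {c c' c₁ c₁' : ℂ}
    (lG : HasLeadingTerm G a b c) (lH : HasLeadingTerm H a' b' c')
    (lG₁ : HasLeadingTerm G₁ a₁ b₁ c₁) (lH₁ : HasLeadingTerm H₁ a₁' b₁' c₁') :
    logWedge G₁ H₁ G H =O[𝓝 0] fun z => weightedNorm z ^
      (weight a₁ b₁ + weight a₁' b₁' + (weight a b + weight a' b')) := by
  have w := add_nonneg (weight_nonneg a b) (weight_nonneg a' b')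
  have w₁ := add_nonneg (weight_nonneg a₁ b₁) (weight_nonneg a₁' b₁')
  have x := quotientDeriv_isBigO hG hH lG lH (u := fun z => (z.1, 0)) (by simp) (by simp)
  have y := quotientDeriv_isBigO hG hH lG lH (u := fun z => (0, z.2)) (by simp) (by simp)
  have x₁ := quotientDeriv_isBigO hG₁ hH₁ lG₁ lH₁ (u := fun z => (z.1, 0)) (by simp) (by simp)
  have y₁ := quotientDeriv_isBigO hG₁ hH₁ lG₁ lH₁ (u := fun z => (0, z.2)) (by simp) (by simp)
  exact (isBigO_weightedNorm_mul w₁ w x₁ y).sub (isBigO_weightedNorm_mul w₁ w y₁ x)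

/-- If `l` is not a root of unity, the exponent vectors `(p, q)` with `l ^ p * m ^ q = 1` are
pairwise proportional. -/
lemma mul_eq_mul_of_zpow_mul_zpow_eq_one {l m : ℂ} (hl : l ≠ 0) (hm : m ≠ 0)
    (hroot : ∀ k : ℕ, 0 < k → l ^ k ≠ 1) {p q p' q' : ℤ}
    (h : l ^ p * m ^ q = 1) (h' : l ^ p' * m ^ q' = 1) : p * q' = q * p' := by
  have hl1 : l ^ (p * q' - q * p') = 1 := by
    have e : (l ^ p * m ^ q) ^ q' = 1 := by rw [h, one_zpow]
    have e' : (l ^ p' * m ^ q') ^ q = 1 := by rw [h', one_zpow]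
    rw [mul_zpow, ← zpow_mul, ← zpow_mul] at e e'
    rw [mul_comm q' q] at e'
    have hne : m ^ (q * q') ≠ 0 := zpow_ne_zero _ hm
    rw [zpow_sub₀ hl, mul_comm q p', div_eq_one_iff_eq (zpow_ne_zero _ hl)]
    exact mul_right_cancel₀ hne (e.trans e'.symm)
  by_contra hne
  refine hroot (p * q' - q * p').natAbs (Int.natAbs_pos.2 (sub_ne_zero.2 hne)) ?_
  rcases Int.natAbs_eq (p * q' - q * p') with h0 | h0
  · rw [← zpow_natCast, ← h0, hl1]
  · rw [← zpow_natCast, ← neg_eq_iff_eq_neg.2 h0, zpow_neg, hl1, inv_one]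

lemma zpow_mul_zpow_eq_one {l m : ℂ} (hl : l ≠ 0) (hm : m ≠ 0) {a b a' b' : ℕ}
    (h : l ^ a * m ^ b = l ^ a' * m ^ b') :
    l ^ ((a : ℤ) - a') * m ^ ((b : ℤ) - b') = 1 := by
  rw [zpow_sub₀ hl, zpow_sub₀ hm]
  simp only [zpow_natCast]
  have h1 : l ^ a' ≠ 0 := pow_ne_zero _ hl
  have h2 : m ^ b' ≠ 0 := pow_ne_zero _ hm
  field_simp
  exact h

/-- Proportional vectors `t`, `e` of weights `> 0` and `≥ 0` satisfy `|t| e = |e| t` for the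
`ℓ¹`-norm; the weights satisfy the same relation. -/
lemma natAbs_mul_eq_of_proportional {t₁ t₂ e₁ e₂ : ℤ} (h : t₁ * e₂ = t₂ * e₁)
    (ht : 0 < (t₁ : ℝ) + t₂ * √2) (he : 0 ≤ (e₁ : ℝ) + e₂ * √2) :
    ((t₁.natAbs + t₂.natAbs : ℕ) : ℤ) * e₁ = ((e₁.natAbs + e₂.natAbs : ℕ) : ℤ) * t₁ ∧
    ((t₁.natAbs + t₂.natAbs : ℕ) : ℤ) * e₂ = ((e₁.natAbs + e₂.natAbs : ℕ) : ℤ) * t₂ ∧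
    ((t₁.natAbs + t₂.natAbs : ℕ) : ℝ) * (e₁ + e₂ * √2)
      = ((e₁.natAbs + e₂.natAbs : ℕ) : ℝ) * (t₁ + t₂ * √2) := by
  have hR : (t₁ : ℝ) * e₂ = t₂ * e₁ := by exact_mod_cast h
  set v := (t₁ : ℝ) + t₂ * √2
  set w := (e₁ : ℝ) + e₂ * √2
  have h1 : w * t₁ = e₁ * v := by simp only [v, w]; linear_combination √2 * hR
  have h2 : w * t₂ = e₂ * v := by simp only [v, w]; linear_combination -hR
  have a1 : w * |(t₁ : ℝ)| = |(e₁ : ℝ)| * v := by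
    have := congrArg abs h1
    rwa [abs_mul, abs_mul, abs_of_nonneg he, abs_of_pos ht] at this
  have a2 : w * |(t₂ : ℝ)| = |(e₂ : ℝ)| * v := by
    have := congrArg abs h2
    rwa [abs_mul, abs_mul, abs_of_nonneg he, abs_of_pos ht] at this
  have c1 : ((t₁.natAbs + t₂.natAbs : ℕ) : ℝ) = |(t₁ : ℝ)| + |(t₂ : ℝ)| := by
    push_cast [Nat.cast_natAbs]; rfl
  have c2 : ((e₁.natAbs + e₂.natAbs : ℕ) : ℝ) = |(e₁ : ℝ)| + |(e₂ : ℝ)| := by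
    push_cast [Nat.cast_natAbs]; rfl
  have key : ((t₁.natAbs + t₂.natAbs : ℕ) : ℝ) * w
      = ((e₁.natAbs + e₂.natAbs : ℕ) : ℝ) * v := by
    rw [c1, c2]; linear_combination a1 + a2
  refine ⟨?_, ?_, key⟩
  · have : ((t₁.natAbs + t₂.natAbs : ℕ) : ℝ) * e₁ = ((e₁.natAbs + e₂.natAbs : ℕ) : ℝ) * t₁ :=
      mul_right_cancel₀ ht.ne' (by linear_combination t₁ * key - (t₁.natAbs + t₂.natAbs : ℕ) * h1)
    apply Int.cast_injective (α := ℝ)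
    rwa [Int.cast_mul, Int.cast_mul, Int.cast_natCast, Int.cast_natCast]
  · have : ((t₁.natAbs + t₂.natAbs : ℕ) : ℝ) * e₂ = ((e₁.natAbs + e₂.natAbs : ℕ) : ℝ) * t₂ :=
      mul_right_cancel₀ ht.ne' (by linear_combination t₂ * key - (t₁.natAbs + t₂.natAbs : ℕ) * h2)
    apply Int.cast_injective (α := ℝ)
    rwa [Int.cast_mul, Int.cast_mul, Int.cast_natCast, Int.cast_natCast]

/-! ### The descent -/

lemma weight_sub_weight (a b a' b' : ℕ) :
    weight a b - weight a' b' = (((a : ℤ) - a' : ℤ) : ℝ) + (((b : ℤ) - b' : ℤ) : ℝ) * √2 := by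
  simp only [weight]; push_cast; ring

lemma logWedge_swap_left (G₁ H₁ G H : ℂ × ℂ → ℂ) (z : ℂ × ℂ) :
    logWedge H₁ G₁ G H z = -logWedge G₁ H₁ G H z := by
  simp only [logWedge, quotientDeriv_swap G₁ H₁]; ring

lemma logWedge_swap_right (G₁ H₁ G H : ℂ × ℂ → ℂ) (z : ℂ × ℂ) :
    logWedge G₁ H₁ H G z = -logWedge G₁ H₁ G H z := by
  simp only [logWedge, quotientDeriv_swap G H]; ring

lemma logWedge_comm (G₁ H₁ G H : ℂ × ℂ → ℂ) (z : ℂ × ℂ) :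
    logWedge G H G₁ H₁ z = -logWedge G₁ H₁ G H z := by
  simp only [logWedge]; ring

lemma HasLeadingTerm.neg {g h : ℂ × ℂ → ℂ} {a b : ℕ} {c : ℂ} (hg : HasLeadingTerm g a b c)
    (hh : ∀ z, h z = -g z) : HasLeadingTerm h a b (-c) := by
  have := (HasLeadingTerm.const (c := -1) (by norm_num)).mul hg
  simp only [zero_add, neg_mul, one_mul] at this
  exact this.congr (Eventually.of_forall fun z => (hh z).symm)

/-- If `dT ∧ dS` is not zero, neither is the numerator of `S`. -/
lemma exists_hasLeadingTerm_of_logWedge {G H G₁ H₁ : ℂ × ℂ → ℂ} (hG : AnalyticAt ℂ G 0)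
    {a b : ℕ} {c : ℂ} (hN : HasLeadingTerm (logWedge G₁ H₁ G H) a b c) :
    ∃ a b c, HasLeadingTerm G a b c := by
  refine exists_hasLeadingTerm hG fun h0 => hN.not_eventuallyEq_zero ?_
  filter_upwards [quotientDeriv_eventually_eq_zero (H := H) h0] with z hz
  simp [logWedge, hz]

/-- The descent. For invariant quotients `T = G₁ / H₁` of positive weight and `S = G / H` of
nonnegative weight, the exponent vectors of the leading terms are proportional, so that a power of
`S` and a multiple of a power of `T` have the same leading term. Replacing `S` by their difference
lowers `weight (dT ∧ dS) - weight S`, which is bounded below, by at least a fixed amount. -/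
lemma logWedge_descent {F : ℂ × ℂ → ℂ × ℂ} (hF0 : Tendsto F (𝓝 0) (𝓝 0)) {l m : ℂ} (hl : l ≠ 0)
    (hm : m ≠ 0) (hroot : ∀ k : ℕ, 0 < k → l ^ k ≠ 1)
    (hF1 : HasLeadingTerm (fun z => (F z).1) 1 0 l)
    (hF2 : HasLeadingTerm (fun z => (F z).2) 0 1 m)
    {G₁ H₁ : ℂ × ℂ → ℂ} (h₁ : IsInvariantQuotient F G₁ H₁) {a₁ b₁ a₁' b₁' : ℕ} {c₁ c₁' : ℂ}
    (lG₁ : HasLeadingTerm G₁ a₁ b₁ c₁) (lH₁ : HasLeadingTerm H₁ a₁' b₁' c₁')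
    (hpos : weight a₁' b₁' < weight a₁ b₁)
    (N : ℕ) {G H : ℂ × ℂ → ℂ} (h : IsInvariantQuotient F G H) {a b a' b' a'' b'' : ℕ} {c c' c'' : ℂ}
    (lG : HasLeadingTerm G a b c) (lH : HasLeadingTerm H a' b' c')
    (hnn : weight a' b' ≤ weight a b)
    (hN : HasLeadingTerm (logWedge G₁ H₁ G H) a'' b'' c'')
    (hlt : weight a'' b'' - (weight a₁ b₁ + weight a₁' b₁' + (weight a b + weight a' b'))
      < N * ((weight a₁ b₁ - weight a₁' b₁')
        / (((a₁ : ℤ) - a₁').natAbs + ((b₁ : ℤ) - b₁').natAbs : ℕ))) : False := by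
  have ht : 0 < (((a₁ : ℤ) - a₁' : ℤ) : ℝ) + (((b₁ : ℤ) - b₁' : ℤ) : ℝ) * √2 := by
    rw [← weight_sub_weight]; linarith
  have r₁ := h₁.mul_pow_eq hF0 hF1 hF2 lG₁ lH₁
  set M := ((a₁ : ℤ) - a₁').natAbs + ((b₁ : ℤ) - b₁').natAbs with hM
  have hM0 : M ≠ 0 := by
    intro h0
    have e1 : (a₁ : ℤ) - a₁' = 0 := by omega
    have e2 : (b₁ : ℤ) - b₁' = 0 := by omega
    rw [e1, e2] at ht
    simp at ht
  have hMpos : (0 : ℝ) < M := by exact_mod_cast Nat.pos_of_ne_zero hM0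
  -- positive weights of exponent vectors of invariants are bounded below by a constant
  have hmin : ∀ {p q p' q' : ℕ}, l ^ p * m ^ q = l ^ p' * m ^ q' → weight p' q' < weight p q →
      (weight a₁ b₁ - weight a₁' b₁') / M ≤ weight p q - weight p' q' := by
    intro p q p' q' hpq hw
    have he : 0 < (((p : ℤ) - p' : ℤ) : ℝ) + (((q : ℤ) - q' : ℤ) : ℝ) * √2 := by
      rw [← weight_sub_weight]; linarith
    have key := (natAbs_mul_eq_of_proportional
      (mul_eq_mul_of_zpow_mul_zpow_eq_one hl hm hroot (zpow_mul_zpow_eq_one hl hm r₁)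
        (zpow_mul_zpow_eq_one hl hm hpq)) ht he.le).2.2
    rw [← weight_sub_weight, ← weight_sub_weight, ← hM] at key
    rw [← weight_sub_weight] at he ht
    rw [div_le_iff₀ hMpos, mul_comm, key]
    have hs : 0 < ((((p : ℤ) - p').natAbs + ((q : ℤ) - q').natAbs : ℕ) : ℝ) := by
      by_contra! hs
      nlinarith [mul_pos hMpos he]
    have hs1 : (1 : ℝ) ≤ ((((p : ℤ) - p').natAbs + ((q : ℤ) - q').natAbs : ℕ) : ℝ) := by
      exact_mod_cast hs
    nlinarith
  set κ := (weight a₁ b₁ - weight a₁' b₁') / (M : ℝ) with hκ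
  induction N generalizing G H a b a' b' a'' b'' c c' c'' with
  | zero =>
    have := hN.le_weight (logWedge_isBigO h.num h.den h₁.num h₁.den lG lH lG₁ lH₁)
    push_cast at hlt
    linarith
  | succ N ih =>
    have r := h.mul_pow_eq hF0 hF1 hF2 lG lH
    have he : 0 ≤ (((a : ℤ) - a' : ℤ) : ℝ) + (((b : ℤ) - b' : ℤ) : ℝ) * √2 := by
      rw [← weight_sub_weight]; linarith
    obtain ⟨k1, k2, -⟩ := natAbs_mul_eq_of_proportional
      (mul_eq_mul_of_zpow_mul_zpow_eq_one hl hm hroot (zpow_mul_zpow_eq_one hl hm r₁)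
        (zpow_mul_zpow_eq_one hl hm r)) ht he
    rw [← hM] at k1 k2
    set s := ((a : ℤ) - a').natAbs + ((b : ℤ) - b').natAbs
    have k1' : s * a₁ + M * a' = M * a + s * a₁' := by zify; linarith
    have k2' : s * b₁ + M * b' = M * b + s * b₁' := by zify; linarith
    have lS := (lG.pow M).mul (lH₁.pow s)
    have lT := (lG₁.pow s).mul (lH.pow M)
    have lD := (lH.pow M).mul (lH₁.pow s)
    rw [k1', k2'] at lT
    obtain ⟨δ, hδ, hO⟩ := lS.sub_mul lT
    set k := c ^ M * c₁' ^ s / (c₁ ^ s * c' ^ M)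
    have h' := h.pow_sub_mul_pow h₁ k M s
    obtain ⟨n, hn⟩ : ∃ n, M = n + 1 := ⟨M - 1, by omega⟩
    -- the factor by which `dT ∧ dS` is multiplied
    have lα := ((HasLeadingTerm.const (c := (n + 1 : ℂ)) (by exact_mod_cast n.succ_ne_zero)).mul
      ((lG.mul lH).pow n)).mul (lH₁.pow (2 * s))
    have lN := (lα.mul hN).congr (h := logWedge G₁ H₁
      (fun z => G z ^ M * H₁ z ^ s - k * (G₁ z ^ s * H z ^ M)) (fun z => H z ^ M * H₁ z ^ s)) (by
        filter_upwards [h.num.eventually_analyticAt, h.den.eventually_analyticAt,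
          h₁.num.eventually_analyticAt, h₁.den.eventually_analyticAt] with z z1 z2 z3 z4
        obtain ⟨β, hβ⟩ := quotientDeriv_pow_sub_mul_pow k n s z1.differentiableAt
          z2.differentiableAt z3.differentiableAt z4.differentiableAt
        simp only [logWedge, hn, hβ]
        ring)
    obtain ⟨p, q, d, lG'⟩ := exists_hasLeadingTerm_of_logWedge h'.num lN
    have hw := lG'.le_weight hO
    have r' := h'.mul_pow_eq hF0 hF1 hF2 lG' lD
    have r'' : l ^ p * m ^ q = l ^ (M * a + s * a₁') * m ^ (M * b + s * b₁') := by
      rw [r']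
      have e := congrArg (· ^ M) r
      simp only [mul_pow, ← pow_mul] at e
      simp only [pow_add]
      rw [mul_comm M a, mul_comm M b, mul_comm M a', mul_comm M b']
      linear_combination -(l ^ (s * a₁') * m ^ (s * b₁')) * e
    have hstep := hmin r'' (by linarith)
    refine ih h' lG' lD ?_ lN ?_
    · have : (M : ℝ) * weight a' b' ≤ M * weight a b := by gcongr
      simp only [weight_add, weight_mul] at hw ⊢
      linarith
    · simp only [weight_add, weight_mul] at hw hstep ⊢
      have hMn : (M : ℝ) = n + 1 := by rw [hn]; push_cast; ring
      rw [hMn] at hstep ⊢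
      push_cast at hlt ⊢
      simp only [weight, Nat.cast_zero, zero_mul, add_zero] at hlt hstep ⊢
      linarith

/-- Two invariant quotients whose wedge product is not zero, which is expressed by its having a
leading term, force the eigenvalue `l` of the linear part to be a root of unity. -/
lemma exists_pow_eq_one_of_logWedge {F : ℂ × ℂ → ℂ × ℂ} (hF0 : Tendsto F (𝓝 0) (𝓝 0)) {l m : ℂ}
    (hl : l ≠ 0) (hm : m ≠ 0)
    (hF1 : HasLeadingTerm (fun z => (F z).1) 1 0 l)
    (hF2 : HasLeadingTerm (fun z => (F z).2) 0 1 m)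
    {G₁ H₁ G H : ℂ × ℂ → ℂ} (h₁ : IsInvariantQuotient F G₁ H₁) (h : IsInvariantQuotient F G H)
    {a'' b'' : ℕ} {c'' : ℂ} (hN : HasLeadingTerm (logWedge G₁ H₁ G H) a'' b'' c'') :
    ∃ k : ℕ, 0 < k ∧ l ^ k = 1 := by
  by_contra! hroot
  -- reduction to a quotient `G₁ / H₁` of positive weight, by inverting it or subtracting a constant
  have main : ∀ {G₁ H₁ : ℂ × ℂ → ℂ} {a₁ b₁ a₁' b₁' : ℕ} {c₁ c₁' c'' : ℂ},
      IsInvariantQuotient F G₁ H₁ → HasLeadingTerm G₁ a₁ b₁ c₁ → HasLeadingTerm H₁ a₁' b₁' c₁' →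
      weight a₁' b₁' < weight a₁ b₁ → HasLeadingTerm (logWedge G₁ H₁ G H) a'' b'' c'' → False := by
    intro G₁ H₁ a₁ b₁ a₁' b₁' c₁ c₁' c'' h₁ lG₁ lH₁ hpos hN
    have hN' := hN.neg (logWedge_swap_right G₁ H₁ G H)
    obtain ⟨a, b, c, lG⟩ := exists_hasLeadingTerm_of_logWedge h.num hN
    obtain ⟨a', b', c', lH⟩ := exists_hasLeadingTerm_of_logWedge h.den hN'
    have hM : 0 < (((a₁ : ℤ) - a₁').natAbs + ((b₁ : ℤ) - b₁').natAbs : ℕ) := by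
      by_contra h0
      have e1 : a₁ = a₁' := by omega
      have e2 : b₁ = b₁' := by omega
      simp [e1, e2] at hpos
    obtain ⟨n, hn⟩ := exists_nat_gt
      ((weight a'' b'' - (weight a₁ b₁ + weight a₁' b₁' + (weight a b + weight a' b'))) /
        ((weight a₁ b₁ - weight a₁' b₁')
        / (((a₁ : ℤ) - a₁').natAbs + ((b₁ : ℤ) - b₁').natAbs : ℕ)))
    have hM' : (0 : ℝ) < (((a₁ : ℤ) - a₁').natAbs + ((b₁ : ℤ) - b₁').natAbs : ℕ) := by
      exact_mod_cast hM
    rw [div_lt_iff₀ (div_pos (by linarith) hM')] at hn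
    rcases le_total (weight a' b') (weight a b) with hle | hle
    · exact logWedge_descent hF0 hl hm hroot hF1 hF2 h₁ lG₁ lH₁ hpos n h lG lH hle hN hn
    · rw [add_comm (weight a b)] at hn
      exact logWedge_descent hF0 hl hm hroot hF1 hF2 h₁ lG₁ lH₁ hpos n h.swap lH lG hle hN' hn
  have hN' := hN.neg (logWedge_swap_left G₁ H₁ G H)
  obtain ⟨a₁, b₁, c₁, lG₁⟩ := exists_hasLeadingTerm_of_logWedge h₁.num
    (hN.neg (logWedge_comm G₁ H₁ G H))
  obtain ⟨a₁', b₁', c₁', lH₁⟩ := exists_hasLeadingTerm_of_logWedge h₁.den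
    (hN'.neg (logWedge_comm H₁ G₁ G H))
  rcases lt_trichotomy (weight a₁' b₁') (weight a₁ b₁) with hlt | heq | hgt
  · exact main h₁ lG₁ lH₁ hlt hN
  · have heq' : ((a₁' : ℤ) : ℝ) + ((b₁' : ℤ) : ℝ) * √2 = ((a₁ : ℤ) : ℝ) + ((b₁ : ℤ) : ℝ) * √2 := by
      simpa [weight] using heq
    obtain ⟨e1, e2⟩ := int_add_int_mul_sqrt_two_injective heq'
    have e1 : a₁' = a₁ := by exact_mod_cast e1
    have e2 : b₁' = b₁ := by exact_mod_cast e2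
    subst e1 e2
    obtain ⟨δ, hδ, hO⟩ := lG₁.sub_mul lH₁
    have h₁' := h₁.sub_const_mul (c₁ / c₁')
    have hN'' := hN.congr (h := logWedge (fun z => G₁ z - c₁ / c₁' * H₁ z) H₁ G H) (by
      filter_upwards [h₁.num.eventually_analyticAt, h₁.den.eventually_analyticAt] with z z1 z2
      simp only [logWedge,
        quotientDeriv_sub_const_mul _ z1.differentiableAt z2.differentiableAt])
    obtain ⟨p, q, d, l'⟩ := exists_hasLeadingTerm_of_logWedge h₁'.num
      (hN''.neg (logWedge_comm _ H₁ G H))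
    exact main h₁' l' lH₁ (by linarith [l'.le_weight hO]) hN''
  · exact main h₁.swap lH₁ lG₁ hgt hN'

/-! ### Triangular coordinates at a fixed point -/

lemma AnalyticAt.sub_fderiv_isBigO_weightedNorm {g : ℂ × ℂ → ℂ} (hg : AnalyticAt ℂ g 0)
    (h0 : g 0 = 0) :
    (fun z => g z - fderiv ℂ g 0 z) =O[𝓝 0] fun z => weightedNorm z ^ (2 : ℝ) := by
  obtain ⟨p, hp⟩ := hg
  refine ((hp.isBigO_sub_partialSum_pow 2).trans (isBigO_norm_pow_weightedNorm 2)).congr_left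
    fun z => ?_
  rw [FormalMultilinearSeries.partialSum, Finset.sum_range_succ, Finset.sum_range_one,
    hp.coeff_zero, h0, hp.fderiv_eq, zero_add, zero_add]
  rfl

lemma hasLeadingTerm_fst_of_fderiv {g : ℂ × ℂ → ℂ} (hg : AnalyticAt ℂ g 0) (h0 : g 0 = 0)
    {l e : ℂ} (hl : l ≠ 0) (hd : ∀ z, fderiv ℂ g 0 z = l * z.1 + e * z.2) :
    HasLeadingTerm g 1 0 l := by
  have h1 : 1 < √2 := Real.lt_sqrt_of_sq_lt (by norm_num)
  have h2 : √2 ≤ 2 := Real.sqrt_le_iff.2 ⟨by norm_num, by norm_num⟩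
  refine ⟨hl, √2 - 1, by linarith, ?_⟩
  have e1 := (hg.sub_fderiv_isBigO_weightedNorm h0).trans
    (weightedNorm_rpow_isBigO (s := √2) (by positivity) h2)
  have e2 := monomial_isBigO e 0 1
  have w1 : weight 0 1 = √2 := by simp [weight]
  have w2 : weight 1 0 + (√2 - 1) = √2 := by simp [weight]
  rw [w1] at e2
  rw [w2]
  refine (e1.add e2).congr_left fun z => ?_
  rw [hd]; ring

lemma hasLeadingTerm_snd_of_fderiv {g : ℂ × ℂ → ℂ} (hg : AnalyticAt ℂ g 0) (h0 : g 0 = 0)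
    {m : ℂ} (hm : m ≠ 0) (hd : ∀ z, fderiv ℂ g 0 z = m * z.2) :
    HasLeadingTerm g 0 1 m := by
  have h2 : √2 < 2 := by rw [Real.sqrt_lt' two_pos]; norm_num
  refine ⟨hm, 2 - √2, by linarith, ?_⟩
  have w2 : weight 0 1 + (2 - √2) = 2 := by simp [weight]
  rw [w2]
  refine (hg.sub_fderiv_isBigO_weightedNorm h0).congr_left fun z => ?_
  rw [hd]; ring

lemma exists_equiv_prod {v : Fin 2 → ℂ} (hv : v ≠ 0) :
    ∃ Φ : (ℂ × ℂ) ≃L[ℂ] (Fin 2 → ℂ), Φ (1, 0) = v := by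
  have hw : ∃ w : Fin 2 → ℂ, ∀ s t : ℂ, s • v + t • w = 0 → s = 0 ∧ t = 0 := by
    by_cases h : v 0 = 0
    · have h1 : v 1 ≠ 0 := fun h1 => hv (by ext i; fin_cases i <;> simp [h, h1])
      refine ⟨![1, 0], fun s t hst => ?_⟩
      have e0 := congrFun hst 0
      have e1 := congrFun hst 1
      simp [h] at e0
      simp [h1] at e1
      exact ⟨e1, e0⟩
    · refine ⟨![0, 1], fun s t hst => ?_⟩
      have e0 := congrFun hst 0
      have e1 := congrFun hst 1
      simp [h] at e0
      simp [e0] at e1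
      exact ⟨e0, e1⟩
  obtain ⟨w, hw⟩ := hw
  let φ : (ℂ × ℂ) →ₗ[ℂ] (Fin 2 → ℂ) :=
    (LinearMap.toSpanSingleton ℂ _ v).coprod (LinearMap.toSpanSingleton ℂ _ w)
  have hinj : Function.Injective φ := by
    rw [injective_iff_map_eq_zero]
    rintro ⟨s, t⟩ hst
    obtain ⟨rfl, rfl⟩ := hw s t (by simpa [φ] using hst)
    rfl
  refine ⟨(LinearEquiv.ofInjectiveOfFinrankEq φ hinj (by simp)).toContinuousLinearEquiv, ?_⟩
  change φ (1, 0) = v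
  simp [φ]

lemma quotientDeriv_comp {G H : (Fin 2 → ℂ) → ℂ} (x : Fin 2 → ℂ)
    (Φ : (ℂ × ℂ) ≃L[ℂ] (Fin 2 → ℂ)) {z : ℂ × ℂ} (hG : DifferentiableAt ℂ G (x + Φ z))
    (hH : DifferentiableAt ℂ H (x + Φ z)) (h0 : H (x + Φ z) ≠ 0) (u : ℂ × ℂ) :
    quotientDeriv (fun z => G (x + Φ z)) (fun z => H (x + Φ z)) z u
      = H (x + Φ z) ^ 2 * fderiv ℂ (fun w => G w / H w) (x + Φ z) (Φ u) := by
  have hΦ : HasFDerivAt (fun z => x + Φ z) (Φ : (ℂ × ℂ) →L[ℂ] (Fin 2 → ℂ)) z :=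
    Φ.hasFDerivAt.const_add x
  have eG : fderiv ℂ (fun z => G (x + Φ z)) z u = fderiv ℂ G (x + Φ z) (Φ u) := by
    have e : HasFDerivAt (fun z => G (x + Φ z)) _ z := hG.hasFDerivAt.comp z hΦ
    rw [e.fderiv]; rfl
  have eH : fderiv ℂ (fun z => H (x + Φ z)) z u = fderiv ℂ H (x + Φ z) (Φ u) := by
    have e : HasFDerivAt (fun z => H (x + Φ z)) _ z := hH.hasFDerivAt.comp z hΦ
    rw [e.fderiv]; rfl
  have hR : DifferentiableAt ℂ (fun w => G w / H w) (x + Φ z) := by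
    simp only [div_eq_mul_inv]
    exact hG.mul ((differentiableAt_inv h0).comp _ hH)
  have hGR : (fun w => H w * (G w / H w)) =ᶠ[𝓝 (x + Φ z)] G := by
    filter_upwards [hH.continuousAt.eventually_ne h0] with w hw
    field_simp
  have e := ((hH.hasFDerivAt.mul hR.hasFDerivAt).congr_of_eventuallyEq hGR.symm).fderiv
  rw [quotientDeriv, eG, eH, e]
  simp
  field_simp
  ring

lemma IsMeromorphicFirstIntegral.isInvariantQuotient {F : (Fin 2 → ℂ) → (Fin 2 → ℂ)}
    {x : Fin 2 → ℂ} {G H : (Fin 2 → ℂ) → ℂ} (h : IsMeromorphicFirstIntegral F x G H)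
    (Φ : (ℂ × ℂ) ≃L[ℂ] (Fin 2 → ℂ)) :
    IsInvariantQuotient (fun z => Φ.symm (F (x + Φ z) - x)) (fun z => G (x + Φ z))
      (fun z => H (x + Φ z)) := by
  have hΦ : AnalyticAt ℂ (fun z => x + Φ z) 0 :=
    analyticAt_const.add ((Φ : (ℂ × ℂ) →L[ℂ] (Fin 2 → ℂ)).analyticAt 0)
  have h0 : x + Φ 0 = x := by simp
  refine ⟨?_, ?_, ?_⟩
  · exact AnalyticAt.fun_comp (by rw [h0]; exact h.analyticAt_num) hΦ
  · exact AnalyticAt.fun_comp (by rw [h0]; exact h.analyticAt_den) hΦ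
  · have ht : Tendsto (fun z => x + Φ z) (𝓝 0) (𝓝 x) := by
      simpa [ContinuousAt] using hΦ.continuousAt
    filter_upwards [ht.eventually h.invariant] with z hz
    simpa using hz

/-- Functional independence means that the wedge product is a nonzero germ. -/
lemma exists_hasLeadingTerm_logWedge {x : Fin 2 → ℂ} {G H : Fin 2 → (Fin 2 → ℂ) → ℂ}
    (hG : ∀ i, AnalyticAt ℂ (G i) x) (hH : ∀ i, AnalyticAt ℂ (H i) x)
    (hind : FunctionallyIndependentAt x G H) (Φ : (ℂ × ℂ) ≃L[ℂ] (Fin 2 → ℂ)) :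
    ∃ a b c, HasLeadingTerm (logWedge (fun z => G 0 (x + Φ z)) (fun z => H 0 (x + Φ z))
      (fun z => G 1 (x + Φ z)) (fun z => H 1 (x + Φ z))) a b c := by
  have hΦ : AnalyticAt ℂ (fun z => x + Φ z) 0 :=
    analyticAt_const.add ((Φ : (ℂ × ℂ) →L[ℂ] (Fin 2 → ℂ)).analyticAt 0)
  have h0 : x + Φ 0 = x := by simp
  have ht : Tendsto (fun z => x + Φ z) (𝓝 0) (𝓝 x) := by
    simpa [ContinuousAt] using hΦ.continuousAt
  have hG' : ∀ i, AnalyticAt ℂ (fun z => G i (x + Φ z)) 0 := fun i =>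
    AnalyticAt.fun_comp (by rw [h0]; exact hG i) hΦ
  have hH' : ∀ i, AnalyticAt ℂ (fun z => H i (x + Φ z)) 0 := fun i =>
    AnalyticAt.fun_comp (by rw [h0]; exact hH i) hΦ
  set θ : Fin 2 → ℂ × ℂ → ℂ × ℂ → ℂ :=
    fun i => quotientDeriv (fun z => G i (x + Φ z)) (fun z => H i (x + Φ z)) with hθ
  have hθa : ∀ i u, AnalyticAt ℂ (fun z => θ i z u) 0 := fun i u => by
    have happ : ∀ {g : ℂ × ℂ → ℂ}, AnalyticAt ℂ g 0 → AnalyticAt ℂ (fun z => fderiv ℂ g z u) 0 :=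
      fun hg => ((ContinuousLinearMap.apply ℂ ℂ u).analyticAt _).fun_comp hg.fderiv
    exact ((hH' i).mul (happ (hG' i))).sub ((hG' i).mul (happ (hH' i)))
  have hdet : AnalyticAt ℂ
      (fun z => θ 0 z (1, 0) * θ 1 z (0, 1) - θ 0 z (0, 1) * θ 1 z (1, 0)) 0 :=
    ((hθa 0 _).mul (hθa 1 _)).sub ((hθa 0 _).mul (hθa 1 _))
  obtain ⟨a, b, c, hlead⟩ := exists_hasLeadingTerm hdet (by
    intro hzero
    have htinv : Tendsto (fun y => Φ.symm (y - x)) (𝓝 x) (𝓝 0) := by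
      have : Continuous fun y => Φ.symm (y - x) := by fun_prop
      simpa using this.tendsto x
    have hev := htinv.eventually hzero
    have hdG : ∀ i, ∀ᶠ y in 𝓝 x, DifferentiableAt ℂ (G i) y := fun i =>
      (hG i).eventually_analyticAt.mono fun y hy => hy.differentiableAt
    have hdH : ∀ i, ∀ᶠ y in 𝓝 x, DifferentiableAt ℂ (H i) y := fun i =>
      (hH i).eventually_analyticAt.mono fun y hy => hy.differentiableAt
    obtain ⟨y, ⟨hyH, hy⟩, hy0, hyG', hyH'⟩ := (hind.and_eventually
      (hev.and ((eventually_all.2 hdG).and (eventually_all.2 hdH)))).exists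
    have hyz : x + Φ (Φ.symm (y - x)) = y := by simp
    have hval : ∀ i u, θ i (Φ.symm (y - x)) u
        = H i y ^ 2 * fderiv ℂ (fun w => G i w / H i w) y (Φ u) := fun i u => by
      have := quotientDeriv_comp (G := G i) (H := H i) x Φ (z := Φ.symm (y - x))
        (by rw [hyz]; exact hyG' i) (by rw [hyz]; exact hyH' i) (by rw [hyz]; exact hyH i) u
      rwa [hyz] at this
    set D : Fin 2 → (Fin 2 → ℂ) →L[ℂ] ℂ := fun i => fderiv ℂ (fun w => G i w / H i w) y with hD
    have hDdet : D 0 (Φ (1, 0)) * D 1 (Φ (0, 1)) - D 0 (Φ (0, 1)) * D 1 (Φ (1, 0)) = 0 := by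
      have hne : H 0 y ^ 2 * H 1 y ^ 2 ≠ 0 :=
        mul_ne_zero (pow_ne_zero _ (hyH 0)) (pow_ne_zero _ (hyH 1))
      refine (mul_eq_zero.1 ?_).resolve_left hne
      simp only [Pi.zero_apply, hval] at hy0
      linear_combination hy0
    have hspan : ∀ s t : ℂ, s * D 0 (Φ (1, 0)) + t * D 1 (Φ (1, 0)) = 0 →
        s * D 0 (Φ (0, 1)) + t * D 1 (Φ (0, 1)) = 0 → s = 0 ∧ t = 0 := by
      intro s t h1 h2
      have hD2 : LinearIndependent ℂ ![D 0, D 1] := by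
        convert hy using 1
        ext i : 1
        fin_cases i <;> rfl
      refine LinearIndependent.pair_iff.1 hD2 s t ?_
      ext1 w
      obtain ⟨u, rfl⟩ := Φ.surjective w
      have hu : u = u.1 • ((1 : ℂ), (0 : ℂ)) + u.2 • ((0 : ℂ), (1 : ℂ)) := by ext <;> simp
      rw [hu]
      simp only [map_add, map_smul, add_apply, smul_apply,
        smul_eq_mul, zero_apply]
      linear_combination u.1 * h1 + u.2 * h2
    obtain ⟨p1, p2⟩ := hspan (D 1 (Φ (1, 0))) (-D 0 (Φ (1, 0))) (by ring)
      (by linear_combination -hDdet)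
    obtain ⟨p3, p4⟩ := hspan (D 1 (Φ (0, 1))) (-D 0 (Φ (0, 1))) (by linear_combination hDdet)
      (by ring)
    have := (hspan 1 0 (by rw [neg_eq_zero.1 p2]; ring) (by rw [neg_eq_zero.1 p4]; ring)).1
    exact one_ne_zero this)
  -- `logWedge` is `x * y` times the wedge product on the coordinate vector fields
  have hxy : HasLeadingTerm (fun z : ℂ × ℂ => z.1 * z.2) 1 1 1 :=
    ⟨one_ne_zero, 1, one_pos, by simpa using isBigO_zero _ _⟩
  refine ⟨_, _, _, (hxy.mul hlead).congr (Eventually.of_forall fun z => ?_)⟩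
  have s1 : ((z.1, 0) : ℂ × ℂ) = z.1 • ((1 : ℂ), (0 : ℂ)) := by ext <;> simp
  have s2 : ((0, z.2) : ℂ × ℂ) = z.2 • ((0 : ℂ), (1 : ℂ)) := by ext <;> simp
  have hsmul : ∀ i (k : ℂ) u, θ i z (k • u) = k * θ i z u := fun i k u => by
    simp only [hθ, quotientDeriv, map_smul, smul_eq_mul]; ring
  change _ = θ 0 z (z.1, 0) * θ 1 z (0, z.2) - θ 0 z (0, z.2) * θ 1 z (z.1, 0)
  rw [s1, s2, hsmul, hsmul, hsmul, hsmul]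
  ring

/-- The linear part of `F` becomes triangular in a basis which starts with the eigenvector `v`, so the
result for triangular maps of `ℂ × ℂ` applies to the conjugate of `F`. -/
lemma exists_pow_eq_one_of_meromorphicFirstIntegrals {F : (Fin 2 → ℂ) → (Fin 2 → ℂ)}
    {x : Fin 2 → ℂ} (hF : AnalyticAt ℂ F x) (hx : F x = x)
    (hinj : Function.Injective (fderiv ℂ F x)) {v : Fin 2 → ℂ} (hv : v ≠ 0) {l : ℂ}
    (hlv : fderiv ℂ F x v = l • v) {G H : Fin 2 → (Fin 2 → ℂ) → ℂ}
    (hGH : ∀ i, IsMeromorphicFirstIntegral F x (G i) (H i))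
    (hind : FunctionallyIndependentAt x G H) : ∃ k : ℕ, 0 < k ∧ l ^ k = 1 := by
  obtain ⟨Φ, hΦ⟩ := exists_equiv_prod hv
  set A := fderiv ℂ F x with hA
  set e := (Φ.symm (A (Φ (0, 1)))).1
  set m := (Φ.symm (A (Φ (0, 1)))).2
  have hAz : ∀ z : ℂ × ℂ, Φ.symm (A (Φ z)) = (l * z.1 + e * z.2, m * z.2) := fun z => by
    have hz : z = z.1 • ((1 : ℂ), (0 : ℂ)) + z.2 • ((0 : ℂ), (1 : ℂ)) := by ext <;> simp
    have h1 : Φ.symm (A (Φ (1, 0))) = (l, 0) := by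
      rw [hΦ, hlv, ← hΦ, ← map_smul, Φ.symm_apply_apply]; simp
    conv_lhs => rw [hz]
    simp only [map_add, map_smul, h1]
    ext
    · simp only [Prod.fst_add, Prod.smul_fst, smul_eq_mul, e]; ring
    · simp only [Prod.snd_add, Prod.smul_snd, smul_eq_mul, m]; ring
  have hinj' : ∀ z : ℂ × ℂ, Φ.symm (A (Φ z)) = 0 → z = 0 := fun z hz =>
    (Φ.symm.injective.comp (hinj.comp Φ.injective)) (by simpa using hz)
  have hl : l ≠ 0 := by
    rintro rfl
    have := hinj' (1, 0) (by rw [hAz]; simp)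
    simp at this
  have hm : m ≠ 0 := by
    intro h0
    have := hinj' (-e, l) (by rw [hAz]; simp [h0]; ring)
    exact hl (congrArg Prod.snd this)
  set F' : ℂ × ℂ → ℂ × ℂ := fun z => Φ.symm (F (x + Φ z) - x) with hF'
  have hΦa : HasFDerivAt (fun z => x + Φ z) (Φ : (ℂ × ℂ) →L[ℂ] (Fin 2 → ℂ)) 0 :=
    Φ.hasFDerivAt.const_add x
  have hΦan : AnalyticAt ℂ (fun z => x + Φ z) 0 :=
    analyticAt_const.add ((Φ : (ℂ × ℂ) →L[ℂ] (Fin 2 → ℂ)).analyticAt 0)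
  have h0 : x + Φ 0 = x := by simp
  have hF'an : AnalyticAt ℂ F' 0 := by
    refine ((Φ.symm : (Fin 2 → ℂ) →L[ℂ] (ℂ × ℂ)).analyticAt _).fun_comp ?_
    exact (AnalyticAt.fun_comp (by rw [h0]; exact hF) hΦan).sub analyticAt_const
  have hF'0 : F' 0 = 0 := by simp [hF', hx]
  have hF'd : HasFDerivAt F' ((Φ.symm : (Fin 2 → ℂ) →L[ℂ] (ℂ × ℂ)).comp
      (A.comp (Φ : (ℂ × ℂ) →L[ℂ] (Fin 2 → ℂ)))) 0 := by
    refine Φ.symm.hasFDerivAt.comp 0 (HasFDerivAt.sub_const x ?_)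
    refine HasFDerivAt.comp 0 ?_ hΦa
    rw [h0]
    exact hF.differentiableAt.hasFDerivAt
  have hF1 : HasLeadingTerm (fun z => (F' z).1) 1 0 l := by
    refine hasLeadingTerm_fst_of_fderiv
      (((ContinuousLinearMap.fst ℂ ℂ ℂ).analyticAt _).fun_comp hF'an) (by simp [hF'0]) hl (e := e)
      fun z => ?_
    refine (DFunLike.congr_fun hF'd.fst.fderiv z).trans ?_
    simpa using congrArg Prod.fst (hAz z)
  have hF2 : HasLeadingTerm (fun z => (F' z).2) 0 1 m := by
    refine hasLeadingTerm_snd_of_fderiv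
      (((ContinuousLinearMap.snd ℂ ℂ ℂ).analyticAt _).fun_comp hF'an) (by simp [hF'0]) hm
      fun z => ?_
    refine (DFunLike.congr_fun hF'd.snd.fderiv z).trans ?_
    simpa using congrArg Prod.snd (hAz z)
  obtain ⟨a, b, c, hN⟩ := exists_hasLeadingTerm_logWedge (fun i => (hGH i).analyticAt_num)
    (fun i => (hGH i).analyticAt_den) hind Φ
  exact exists_pow_eq_one_of_logWedge (by simpa [ContinuousAt, hF'0] using hF'an.continuousAt)
    hl hm hF1 hF2 ((hGH 0).isInvariantQuotient Φ) ((hGH 1).isInvariantQuotient Φ) hN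

/-! ### Real planar maps and monomial maps -/

lemma IsComplexificationAt.fderiv_eq {f : (Fin 2 → ℝ) → (Fin 2 → ℝ)} {x : Fin 2 → ℝ}
    {F : (Fin 2 → ℂ) → (Fin 2 → ℂ)} (h : IsComplexificationAt f x F) (hf : AnalyticAt ℝ f x) :
    (fderiv ℂ F (realToComplex x) : (Fin 2 → ℂ) →ₗ[ℂ] (Fin 2 → ℂ))
      = Matrix.toLin' ((jacobianMatrix f x).map (algebraMap ℝ ℂ)) := by
  let ι : (Fin 2 → ℝ) →L[ℝ] (Fin 2 → ℂ) :=
    ContinuousLinearMap.pi fun i => Complex.ofRealCLM.comp (ContinuousLinearMap.proj i)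
  have hι : ∀ v, ι v = realToComplex v := fun v => rfl
  have hF : HasFDerivAt F ((fderiv ℂ F (ι x)).restrictScalars ℝ) (ι x) :=
    (h.1.differentiableAt.hasFDerivAt).restrictScalars ℝ
  have h1 : HasFDerivAt (fun y => F (ι y)) (((fderiv ℂ F (ι x)).restrictScalars ℝ).comp ι) x :=
    hF.comp x ι.hasFDerivAt
  have h2 : HasFDerivAt (fun y => ι (f y)) (ι.comp (fderiv ℝ f x)) x :=
    ι.hasFDerivAt.comp x hf.differentiableAt.hasFDerivAt
  have h3 := h1.unique (h2.congr_of_eventuallyEq h.2)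
  refine LinearMap.pi_ext' fun j => LinearMap.ext_ring ?_
  have h4 := DFunLike.congr_fun h3 (Pi.single j 1)
  have hs : ι (Pi.single j 1) = Pi.single j 1 := by
    rw [hι]; ext i
    by_cases hij : i = j
    · subst hij; simp [realToComplex]
    · simp [realToComplex, hij]
  simp only [ContinuousLinearMap.comp_apply, ContinuousLinearMap.coe_restrictScalars', hs] at h4
  simp only [LinearMap.comp_apply, LinearMap.coe_single, ContinuousLinearMap.coe_coe]
  rw [← hι, h4, Matrix.toLin'_apply, Matrix.mulVec_single_one]
  ext i
  simp [hι, realToComplex, jacobianMatrix, LinearMap.toMatrix'_apply]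

lemma exists_pow_eq_one_of_hasEigenvalue {f : (Fin 2 → ℝ) → (Fin 2 → ℝ)} {x : Fin 2 → ℝ}
    (hf : AnalyticAt ℝ f x) (hx : f x = x) (hdet : (jacobianMatrix f x).det ≠ 0)
    (h : HasIndependentMeromorphicFirstIntegrals 2 f x) {μ : ℂ}
    (hμ : Module.End.HasEigenvalue
      (Matrix.toLin' ((jacobianMatrix f x).map (algebraMap ℝ ℂ))) μ) :
    ∃ k : ℕ, 0 < k ∧ μ ^ k = 1 := by
  obtain ⟨F, G, H, hF, hGH, hind⟩ := h
  have hd := hF.fderiv_eq hf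
  have hd' : ∀ v, fderiv ℂ F (realToComplex x) v
      = Matrix.toLin' ((jacobianMatrix f x).map (algebraMap ℝ ℂ)) v := fun v =>
    DFunLike.congr_fun hd v
  obtain ⟨v, hv⟩ := hμ.exists_hasEigenvector
  refine exists_pow_eq_one_of_meromorphicFirstIntegrals hF.1 ?_ ?_ hv.2
    ((hd' v).trans hv.apply_eq_smul) hGH hind
  · rw [hF.2.self_of_nhds, hx]
  · have hu : IsUnit ((jacobianMatrix f x).map (algebraMap ℝ ℂ)) := by
      rw [Matrix.isUnit_iff_isUnit_det, isUnit_iff_ne_zero]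
      have : ((jacobianMatrix f x).map (algebraMap ℝ ℂ)).det
          = algebraMap ℝ ℂ (jacobianMatrix f x).det := by
        rw [RingHom.map_det]; rfl
      rw [this]
      simpa using hdet
    intro v w hvw
    rw [hd', hd', Matrix.toLin'_apply, Matrix.toLin'_apply] at hvw
    exact Matrix.mulVec_injective_of_isUnit hu hvw

lemma Real.eq_one_or_eq_neg_one_of_pow_eq_one {r : ℝ} {k : ℕ} (hk : 0 < k)
    (h : (r : ℂ) ^ k = 1) : r = 1 ∨ r = -1 := by
  have h1 : ‖(r : ℂ)‖ = 1 := Complex.norm_eq_one_of_pow_eq_one h hk.ne'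
  rw [Complex.norm_real, Real.norm_eq_abs] at h1
  exact eq_or_eq_neg_of_abs_eq h1

/-- The coefficients of a real quadratic polynomial all of whose roots are roots of unity. -/
lemma coeff_eq_of_roots_pow_eq_one {b c : ℝ}
    (h : ∀ μ : ℂ, μ ^ 2 + b * μ + c = 0 → ∃ k : ℕ, 0 < k ∧ μ ^ k = 1) :
    (b ^ 2 - 4 * c < 0 → c = 1) ∧
    (¬ b ^ 2 - 4 * c < 0 → (b, c) ∈ ({(2, 1), (-2, 1), (0, -1)} : Set (ℝ × ℝ))) := by
  constructor
  · intro hneg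
    set s := √(4 * c - b ^ 2) with hs
    have hs2 : s ^ 2 = 4 * c - b ^ 2 := Real.sq_sqrt (by linarith)
    have hs2' : (s : ℂ) ^ 2 = 4 * c - b ^ 2 := by exact_mod_cast congrArg ((↑) : ℝ → ℂ) hs2
    obtain ⟨k, hk, hk1⟩ := h ⟨-b / 2, s / 2⟩ (by
      have : (⟨-b / 2, s / 2⟩ : ℂ) = (-b + s * Complex.I) / 2 := by
        apply Complex.ext <;> simp
      rw [this]
      linear_combination (1 / 4 : ℂ) * s ^ 2 * Complex.I_sq - (1 / 4 : ℂ) * hs2')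
    have hn := Complex.norm_eq_one_of_pow_eq_one hk1 hk.ne'
    have hn2 : Complex.normSq ⟨-b / 2, s / 2⟩ = 1 := by
      rw [Complex.normSq_eq_norm_sq, hn, one_pow]
    rw [Complex.normSq_mk] at hn2
    linarith
  · intro hnn
    set s := √(b ^ 2 - 4 * c) with hs
    have hs2 : s ^ 2 = b ^ 2 - 4 * c := Real.sq_sqrt (by linarith)
    have hs2' : (s : ℂ) ^ 2 = b ^ 2 - 4 * c := by exact_mod_cast congrArg ((↑) : ℝ → ℂ) hs2
    obtain ⟨k, hk, hk1⟩ := h ((-b + s) / 2 : ℝ) (by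
      push_cast
      linear_combination (1 / 4 : ℂ) * hs2')
    obtain ⟨k', hk', hk1'⟩ := h ((-b - s) / 2 : ℝ) (by
      push_cast
      linear_combination (1 / 4 : ℂ) * hs2')
    have hc : c = ((-b + s) / 2) * ((-b - s) / 2) := by linear_combination (1 / 4 : ℝ) * hs2
    have hb : b = -((-b + s) / 2 + (-b - s) / 2) := by ring
    simp only [Set.mem_insert_iff, Set.mem_singleton_iff, Prod.mk.injEq]
    rcases Real.eq_one_or_eq_neg_one_of_pow_eq_one hk hk1 with e | e <;>
    rcases Real.eq_one_or_eq_neg_one_of_pow_eq_one hk' hk1' with e' | e' <;>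
    rw [e, e'] at hb hc <;> norm_num at hb hc <;> simp [hb, hc]

lemma eigenvalues_of_independent_meromorphicFirstIntegrals {f : (Fin 2 → ℝ) → (Fin 2 → ℝ)}
    {x : Fin 2 → ℝ} {b c : ℝ} (hf : AnalyticAt ℝ f x) (hx : f x = x)
    (hchar : (jacobianMatrix f x).charpoly
      = Polynomial.X ^ 2 + Polynomial.C b * Polynomial.X + Polynomial.C c)
    (hc : c ≠ 0) (h : HasIndependentMeromorphicFirstIntegrals 2 f x) :
    (∀ μ : ℂ, Module.End.HasEigenvalue
        (Matrix.toLin' ((jacobianMatrix f x).map (algebraMap ℝ ℂ))) μ →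
      ∃ k : ℕ, 0 < k ∧ μ ^ k = 1) ∧
    (b ^ 2 - 4 * c < 0 → c = 1) ∧
    (¬ b ^ 2 - 4 * c < 0 → (b, c) ∈ ({(2, 1), (-2, 1), (0, -1)} : Set (ℝ × ℝ))) := by
  have hdet : (jacobianMatrix f x).det ≠ 0 := by
    rw [Matrix.det_eq_sign_charpoly_coeff, hchar]
    simpa using hc
  have key : ∀ μ : ℂ, Module.End.HasEigenvalue
      (Matrix.toLin' ((jacobianMatrix f x).map (algebraMap ℝ ℂ))) μ →
      ∃ k : ℕ, 0 < k ∧ μ ^ k = 1 := fun μ hμ =>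
    exists_pow_eq_one_of_hasEigenvalue hf hx hdet h hμ
  refine ⟨key, coeff_eq_of_roots_pow_eq_one fun μ hμ => key μ ?_⟩
  rw [Module.End.hasEigenvalue_iff_isRoot_charpoly, Matrix.charpoly_toLin', Matrix.charpoly_map,
    hchar]
  simpa using hμ

lemma analyticAt_monomialMap (p q : ℤ) : AnalyticAt ℝ (monomialMap p q) ![1, 1] := by
  have h0 : AnalyticAt ℝ (fun v : Fin 2 → ℝ => v 0) ![1, 1] :=
    (ContinuousLinearMap.proj (R := ℝ) (φ := fun _ : Fin 2 => ℝ) 0).analyticAt _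
  have h1 : AnalyticAt ℝ (fun v : Fin 2 → ℝ => v 1) ![1, 1] :=
    (ContinuousLinearMap.proj (R := ℝ) (φ := fun _ : Fin 2 => ℝ) 1).analyticAt _
  refine AnalyticAt.pi fun i => ?_
  fin_cases i
  · exact h1
  · exact (h0.zpow (n := p) (by simp)).mul (h1.zpow (n := q) (by simp))

lemma jacobianMatrix_monomialMap (p q : ℤ) :
    jacobianMatrix (monomialMap p q) ![1, 1] = !![0, 1; (p : ℝ), (q : ℝ)] := by
  have h0 : HasFDerivAt (fun v : Fin 2 → ℝ => v 0) (ContinuousLinearMap.proj 0) ![1, 1] :=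
    (ContinuousLinearMap.proj (R := ℝ) (φ := fun _ : Fin 2 => ℝ) 0).hasFDerivAt
  have h1 : HasFDerivAt (fun v : Fin 2 → ℝ => v 1) (ContinuousLinearMap.proj 1) ![1, 1] :=
    (ContinuousLinearMap.proj (R := ℝ) (φ := fun _ : Fin 2 => ℝ) 1).hasFDerivAt
  have e0 := (hasDerivAt_zpow p (1 : ℝ) (Or.inl one_ne_zero)).comp_hasFDerivAt_of_eq
    (![1, 1] : Fin 2 → ℝ) h0 rfl
  have e1 := (hasDerivAt_zpow q (1 : ℝ) (Or.inl one_ne_zero)).comp_hasFDerivAt_of_eq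
    (![1, 1] : Fin 2 → ℝ) h1 rfl
  have hd : ∀ i, HasFDerivAt (fun v => monomialMap p q v i)
      ((ContinuousLinearMap.proj i).comp (fderiv ℝ (monomialMap p q) ![1, 1])) ![1, 1] :=
    hasFDerivAt_pi'.1 (analyticAt_monomialMap p q).differentiableAt.hasFDerivAt
  have d0 := (hd 0).unique h1
  have d1 := (hd 1).unique (e0.mul e1)
  ext i j
  rw [jacobianMatrix, LinearMap.toMatrix'_apply]
  fin_cases i
  · refine (DFunLike.congr_fun d0 _).trans ?_
    fin_cases j <;> simp
  · refine (DFunLike.congr_fun d1 _).trans ?_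
    fin_cases j <;> simp

theorem mainTheorem5 :
    (∀ (f : (Fin 2 → ℝ) → (Fin 2 → ℝ)) (x : Fin 2 → ℝ) (b c : ℝ),
      AnalyticAt ℝ f x → f x = x →
      (jacobianMatrix f x).charpoly
        = Polynomial.X ^ 2 + Polynomial.C b * Polynomial.X + Polynomial.C c →
      c ≠ 0 →
      HasIndependentMeromorphicFirstIntegrals 2 f x →
        (∀ μ : ℂ, Module.End.HasEigenvalue
            (Matrix.toLin' ((jacobianMatrix f x).map (algebraMap ℝ ℂ))) μ →
          ∃ k : ℕ, 0 < k ∧ μ ^ k = 1) ∧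
        (b ^ 2 - 4 * c < 0 → c = 1) ∧
        (¬ b ^ 2 - 4 * c < 0 →
          (b, c) ∈ ({(2, 1), (-2, 1), (0, -1)} : Set (ℝ × ℝ)))) ∧
    (∀ p q : ℤ, p ≠ 0 →
      HasIndependentMeromorphicFirstIntegrals 2 (monomialMap p q) ![1, 1] →
        (p, q) ∈ ({(-1, -2), (-1, 2), (1, 0), (-1, -1), (-1, 0), (-1, 1)} : Set (ℤ × ℤ))) := by
  refine ⟨fun f x b c hf hx hchar hc h =>
    eigenvalues_of_independent_meromorphicFirstIntegrals hf hx hchar hc h, fun p q hp h => ?_⟩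
  have hfix : monomialMap p q ![1, 1] = ![1, 1] := by
    ext i; fin_cases i <;> simp [monomialMap]
  have hchar : (jacobianMatrix (monomialMap p q) ![1, 1]).charpoly
      = Polynomial.X ^ 2 + Polynomial.C (-q : ℝ) * Polynomial.X + Polynomial.C (-p : ℝ) := by
    rw [jacobianMatrix_monomialMap, Matrix.charpoly_fin_two]
    simp [Matrix.trace_fin_two, Matrix.det_fin_two]
    ring
  obtain ⟨-, h1, h2⟩ := eigenvalues_of_independent_meromorphicFirstIntegrals
    (analyticAt_monomialMap p q) hfix hchar (by simpa using hp) h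
  simp only [Set.mem_insert_iff, Set.mem_singleton_iff, Prod.mk.injEq] at h2 ⊢
  by_cases hd : (-q : ℝ) ^ 2 - 4 * (-p : ℝ) < 0
  · have hp1 : p = -1 := by
      have := h1 hd
      have : (p : ℝ) = ((-1 : ℤ) : ℝ) := by push_cast; linarith
      exact_mod_cast this
    subst hp1
    have hq : q ^ 2 < 4 := by
      have : (q : ℝ) ^ 2 < 4 := by push_cast at hd; linarith
      exact_mod_cast this
    have hq1 : q < 2 := by nlinarith
    have hq2 : -2 < q := by nlinarith
    omega
  · have hcast : (q = -2 ∧ p = -1) ∨ (q = 2 ∧ p = -1) ∨ (q = 0 ∧ p = 1) := by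
      rcases h2 hd with ⟨e1, e2⟩ | ⟨e1, e2⟩ | ⟨e1, e2⟩
      · left; constructor <;> (rify; linarith)
      · right; left; constructor <;> (rify; linarith)
      · right; right; constructor <;> (rify; linarith)
    omega
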